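/- Let $k$ be a field, and let $R$ and $S$ be standard graded $k$-algebras, i.e. commutative noetherian $\mathbb N$-graded $k$-algebras with $R_0=k$, $S_0=k$, generated as $k$-algebras by their elements of degree $1$. Let $T=R\otimes_k S$, graded by total degree. For a standard graded $k$-algebra $A$ with graded maximal ideal $\mathfrak m$ (so that $k\cong A/\mathfrak m$), and a finitely generated graded $A$-module $M$, let $\operatorname{pd}_A M$ denote the projective dimension of $M$ and let $$\operatorname{reg}_A M=\sup\{j-i : \operatorname{Tor}^A_i(k,M)_j\neq 0\};$$ both may be $+\infty$. A proper homogeneous ideal $I\subseteq A$ is said to be of small type if for all $r\ge 1$ and all $i\ge 0$ the map $\operatorname{Tor}^A_i(k,I^r)\to \operatorname{Tor}^A_i(k,I^{r-1})$ induced by the inclusion $I^r\subseteq I^{r-1}$ is zero (where $I^0=A$). Let $I\subseteq R$ and $J\subseteq S$ be proper homogeneous ideals of small type such that $I^i\neq 0$ and $J^i\ne 0$ for all $i\ge 1$. Let $P=IT+JT\subseteq T$. Then for all $s\ge 1$, $$\operatorname{pd}_T P^s=\max_{i\in[1,s-1],\ j\in[1,s]}\left\{\operatorname{pd}_R I^{s-i}+\operatorname{pd}_S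 J^i,\ \operatorname{pd}_R I^{s-j+1}+\operatorname{pd}_S J^j+1\right\},$$ $$\operatorname{reg}_T P^s=\max_{i\in[1,s-1],\ j\in[1,s]}\left\{\operatorname{reg}_R I^{s-i}+\operatorname{reg}_S J^i,\ \operatorname{reg}_R I^{s-j+1}+\operatorname{reg}_S J^j-1\right\},$$ where $i$ and $j$ range over integers; for $s=1$ there are no terms indexed by $i$, and the maximum is taken over the terms indexed by $j$ only. -/

import Mathlib

open CategoryTheory
open scoped TensorProduct

universe u v w

/-- `𝒜` is a standard grading of the `k`-algebra `A`: the ring `A` is noetherian, the degree zero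
part is `k`, and `A` is generated as a `k`-algebra by its elements of degree one. -/
structure IsStandardGraded {k : Type u} [Field k] {A : Type v} [CommRing A] [Algebra k A]
    (𝒜 : ℕ → Submodule k A) [GradedAlgebra 𝒜] : Prop where
  nontrivial : Nontrivial A
  noetherian : IsNoetherianRing A
  degree_zero : 𝒜 0 = (⊥ : Subalgebra k A).toSubmodule
  generated : Algebra.adjoin k (𝒜 1 : Set A) = ⊤

/-- The ideal generated by the elements of positive degree. For a standard graded algebra over a
field this is the graded maximal ideal. -/
def gradedMaximalIdeal {k : Type u} [Field k] {A : Type v} [CommRing A] [Algebra k A]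
    (𝒜 : ℕ → Submodule k A) : Ideal A :=
  Ideal.span {a : A | ∃ n : ℕ, 0 < n ∧ a ∈ 𝒜 n}

/-- An ideal `I` is of small type if for all `r ≥ 1` and all `i ≥ 0` the map
`Tor_i(k, I ^ r) ⟶ Tor_i(k, I ^ (r - 1))` induced by the inclusion is zero. Here `k` is the
`A`-module `A ⧸ 𝔪`. -/
def IsSmallType {k : Type u} [Field k] {A : Type v} [CommRing A] [Algebra k A]
    (𝒜 : ℕ → Submodule k A) (I : Ideal A) : Prop :=
  ∀ r i : ℕ,
    ((Tor (ModuleCat.{v} A) i).obj (ModuleCat.of A (A ⧸ gradedMaximalIdeal 𝒜))).map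
      (ModuleCat.ofHom (Submodule.inclusion (Ideal.pow_le_pow_right (I := I) (Nat.le_succ r)))) = 0

/-- The projective dimension of an ideal, as a module over the ring. -/
noncomputable def idealProjDim {A : Type v} [CommRing A] (I : Ideal A) : WithBot ℕ∞ :=
  projectiveDimension (ModuleCat.of A I)

/-- The degree `j` part of the graded free module `⨁ e, A(-deg e)`: those `f` whose coordinate at
`e` is homogeneous of degree `j - deg e` (and zero if this number is negative). -/
noncomputable def freeGrading {k : Type u} [Field k] {A : Type v} [CommRing A] [Algebra k A]
    (𝒜 : ℕ → Submodule k A) {ι : Type v} (deg : ι → ℕ) (j : ℕ) : Submodule k (ι →₀ A) :=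
  ⨅ e : ι, (if deg e ≤ j then 𝒜 (j - deg e) else ⊥).comap
    ((Finsupp.lapply e : (ι →₀ A) →ₗ[A] A).restrictScalars k)

/-- A graded free resolution `⋯ ⟶ F₁ ⟶ F₀ ⟶ M ⟶ 0` of a graded `A`-module `M`, with
`F_i = ⨁ e, A(-deg e)` and with differentials and augmentation preserving degrees. -/
structure GradedFreeResolution {k : Type u} [Field k] {A : Type v} [CommRing A] [Algebra k A]
    (𝒜 : ℕ → Submodule k A) {M : Type v} [AddCommGroup M] [Module A M] [Module k M]
    [IsScalarTower k A M]
    (ℳ : ℕ → Submodule k M) where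
  ι : ℕ → Type v
  deg : ∀ i, ι i → ℕ
  d : ∀ i, (ι (i + 1) →₀ A) →ₗ[A] (ι i →₀ A)
  aug : (ι 0 →₀ A) →ₗ[A] M
  d_homogeneous : ∀ i e, d i (Finsupp.single e 1) ∈ freeGrading 𝒜 (deg i) (deg (i + 1) e)
  aug_homogeneous : ∀ e, aug (Finsupp.single e 1) ∈ ℳ (deg 0 e)
  exact_succ : ∀ i, Function.Exact (d (i + 1)) (d i)
  exact_zero : Function.Exact (d 0) aug
  aug_surjective : Function.Surjective aug

namespace GradedFreeResolution

variable {k : Type u} [Field k] {A : Type v} [CommRing A] [Algebra k A]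
  {𝒜 : ℕ → Submodule k A} {M : Type v} [AddCommGroup M] [Module A M] [Module k M]
    [IsScalarTower k A M]
  {ℳ : ℕ → Submodule k M}

/-- The elements of `F_i` whose class in `k ⊗ F_i = F_i / 𝔪 F_i` is a cycle of `k ⊗ F`. -/
noncomputable def cycles (F : GradedFreeResolution 𝒜 ℳ) : ∀ i, Submodule A (F.ι i →₀ A)
  | 0 => ⊤
  | i + 1 => (gradedMaximalIdeal 𝒜 • (⊤ : Submodule A (F.ι i →₀ A))).comap (F.d i)

/-- The elements of `F_i` whose class in `k ⊗ F_i = F_i / 𝔪 F_i` is a boundary of `k ⊗ F`. -/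
noncomputable def boundaries (F : GradedFreeResolution 𝒜 ℳ) (i : ℕ) : Submodule A (F.ι i →₀ A) :=
  LinearMap.range (F.d i) ⊔ gradedMaximalIdeal 𝒜 • (⊤ : Submodule A (F.ι i →₀ A))

/-- `Tor_i(k, M)_j`, the degree `j` part of the `i`-th homology of `k ⊗ F`, computed with the
graded free resolution `F` of `M`: the classes of the cycles of degree `j` modulo boundaries. -/
noncomputable def torDegree (F : GradedFreeResolution 𝒜 ℳ) (i j : ℕ) :
    Submodule k ((F.ι i →₀ A) ⧸ F.boundaries i) :=
  ((F.cycles i).restrictScalars k ⊓ freeGrading 𝒜 (F.deg i) j).map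
    ((F.boundaries i).mkQ.restrictScalars k)

end GradedFreeResolution

/-- The regularity `sup {j - i | Tor_i(k, M)_j ≠ 0}` of the graded module `M` over `A`. The spaces
`Tor_i(k, M)_j` are computed by a graded free resolution; up to isomorphism they do not depend on
it. The value is `⊤` if the set is unbounded, and `⊥` for the zero module. -/
noncomputable def regularity {k : Type u} [Field k] {A : Type v} [CommRing A] [Algebra k A]
    (𝒜 : ℕ → Submodule k A) {M : Type v} [AddCommGroup M] [Module A M] [Module k M]
    [IsScalarTower k A M]
    (ℳ : ℕ → Submodule k M) : EReal :=
  sSup {x : EReal | ∃ i j : ℕ,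
    (∃ F : GradedFreeResolution 𝒜 ℳ, F.torDegree i j ≠ ⊥) ∧
      x = (((j : ℝ) - (i : ℝ) : ℝ) : EReal)}

/-- The grading which an ideal inherits from the ring. -/
def idealGrading {k : Type u} [Field k] {A : Type v} [CommRing A] [Algebra k A]
    (𝒜 : ℕ → Submodule k A) (I : Ideal A) (j : ℕ) : Submodule k I :=
  (𝒜 j).comap ((Submodule.subtype I).restrictScalars k)

/-- The regularity of an ideal, as a graded module over the ring. -/
noncomputable def idealReg {k : Type u} [Field k] {A : Type v} [CommRing A] [Algebra k A]
    (𝒜 : ℕ → Submodule k A) (I : Ideal A) : EReal :=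
  regularity 𝒜 (idealGrading 𝒜 I)

/-- The grading of `R ⊗ S` by total degree: the part of degree `n` is `⨁ R_a ⊗ S_b` over
`a + b = n`. -/
def tensorGrading {k : Type u} [Field k] {R : Type v} [CommRing R] [Algebra k R]
    {S : Type w} [CommRing S] [Algebra k S] (𝒜 : ℕ → Submodule k R) (ℬ : ℕ → Submodule k S)
    (n : ℕ) : Submodule k (R ⊗[k] S) :=
  ⨆ p ∈ Finset.HasAntidiagonal.antidiagonal n,
    LinearMap.range (TensorProduct.map (𝒜 p.1).subtype (ℬ p.2).subtype)

/-- The mixed sum of `I` and `J`: the sum of their extensions to `R ⊗ S`. -/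
def mixedSum (k : Type u) [Field k] {R : Type v} [CommRing R] [Algebra k R]
    {S : Type w} [CommRing S] [Algebra k S] (I : Ideal R) (J : Ideal S) : Ideal (R ⊗[k] S) :=
  I.map (Algebra.TensorProduct.includeLeft : R →ₐ[k] R ⊗[k] S) ⊔
    J.map (Algebra.TensorProduct.includeRight : S →ₐ[k] R ⊗[k] S)

/-!
The powers of `I` and `J` have minimal resolutions `X a` and `Y b`. Small type means that the
inclusions `I ^ (a + 1) ≤ I ^ a` lift to chain maps with entries in the graded maximal ideal, and
similarly for `J`. Over a field, `X a ⊗ Y b` is a minimal resolution of the product of the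
extensions of `I ^ a` and `J ^ b`, and these products, for `a + b = s`, sum up to `P ^ s`. Adding
them one at a time, each new product meets the sum `P_t` of the previous ones in
`P_t ⊓ I ^ (s - t - 1) J ^ (t + 1) = I ^ (s - t) J ^ (t + 1)`, whose two inclusions both lift to
chain maps with entries in the maximal ideal. The mapping cone of the resulting comparison is
therefore again minimal, so the bidegrees of the generators of a minimal resolution of `P ^ s` are
those of the `X (s - i) ⊗ Y i` together with those of the `X (s - j + 1) ⊗ Y j` in homological
degree one higher. The terms `i = 0` and `i = s`, which involve the unit ideal, are dominated by
terms of the second kind.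
-/

section GradedFree

variable {k : Type u} [Field k] {A : Type v} [CommRing A] [Algebra k A]

theorem mem_gradedMaximalIdeal_of_mem {𝒜 : ℕ → Submodule k A} {a : A} {n : ℕ} (hn : 0 < n)
    (ha : a ∈ 𝒜 n) : a ∈ gradedMaximalIdeal 𝒜 :=
  Ideal.subset_span ⟨n, hn, ha⟩

theorem gradedMaximalIdeal_eq_irrelevant (𝒜 : ℕ → Submodule k A) [GradedAlgebra 𝒜] :
    gradedMaximalIdeal 𝒜 = (HomogeneousIdeal.irrelevant 𝒜).toIdeal := by
  rw [HomogeneousIdeal.irrelevant_eq_span, gradedMaximalIdeal]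
  congr 1
  ext a
  simp

theorem mem_gradedMaximalIdeal_iff (𝒜 : ℕ → Submodule k A) [GradedAlgebra 𝒜] {a : A} :
    a ∈ gradedMaximalIdeal 𝒜 ↔ (DirectSum.decompose 𝒜 a 0 : A) = 0 := by
  rw [gradedMaximalIdeal_eq_irrelevant]
  exact HomogeneousIdeal.mem_irrelevant_iff 𝒜 a

theorem one_notMem_gradedMaximalIdeal (𝒜 : ℕ → Submodule k A) [GradedAlgebra 𝒜] [Nontrivial A] :
    1 ∉ gradedMaximalIdeal 𝒜 := by
  rw [mem_gradedMaximalIdeal_iff,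
    DirectSum.decompose_of_mem_same 𝒜 (SetLike.GradedOne.one_mem (A := 𝒜))]
  exact one_ne_zero

theorem exists_sub_algebraMap_mem_gradedMaximalIdeal {𝒜 : ℕ → Submodule k A} [GradedAlgebra 𝒜]
    (h0 : 𝒜 0 = (⊥ : Subalgebra k A).toSubmodule) (a : A) :
    ∃ c : k, a - algebraMap k A c ∈ gradedMaximalIdeal 𝒜 := by
  have ha : (DirectSum.decompose 𝒜 a 0 : A) ∈ (⊥ : Subalgebra k A).toSubmodule :=
    h0.le (DirectSum.decompose 𝒜 a 0).2
  obtain ⟨c, hc⟩ := Algebra.mem_bot.1 ha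
  refine ⟨c, ?_⟩
  rw [mem_gradedMaximalIdeal_iff, hc]
  simp

theorem mem_smul_top_finsupp_iff {ι : Type*} {m : Ideal A} {x : ι →₀ A} :
    x ∈ m • (⊤ : Submodule A (ι →₀ A)) ↔ ∀ e, x e ∈ m := by
  constructor
  · intro hx e
    induction hx using Submodule.smul_induction_on' with
    | smul a ha y _ => exact m.mul_mem_right _ ha
    | add y _ z _ hy hz => exact add_mem hy hz
  · intro h
    rw [← x.sum_single]
    refine Submodule.sum_mem _ fun e _ => ?_
    rw [← mul_one (x e), ← smul_eq_mul, ← Finsupp.smul_single]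
    exact Submodule.smul_mem_smul (h e) trivial

/-- The homogeneous elements of degree `j` of `A(-m)`. -/
def shiftedPart (𝒜 : ℕ → Submodule k A) (m j : ℕ) : Submodule k A :=
  if m ≤ j then 𝒜 (j - m) else ⊥

variable {𝒜 : ℕ → Submodule k A}

theorem mem_shiftedPart_iff {m j : ℕ} {a : A} :
    a ∈ shiftedPart 𝒜 m j ↔ a = 0 ∨ ∃ n, j = m + n ∧ a ∈ 𝒜 n := by
  rw [shiftedPart]
  split_ifs with h
  · obtain ⟨n, rfl⟩ := Nat.exists_eq_add_of_le h
    have : a = 0 → a ∈ 𝒜 n := by rintro rfl; exact zero_mem _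
    simpa using this
  · rw [Submodule.mem_bot, or_iff_left]
    rintro ⟨n, rfl, -⟩
    exact h (Nat.le_add_right m n)

theorem mem_shiftedPart_add {m n : ℕ} {a : A} (ha : a ∈ 𝒜 n) : a ∈ shiftedPart 𝒜 m (m + n) :=
  mem_shiftedPart_iff.2 (Or.inr ⟨n, rfl, ha⟩)

theorem mem_gradedMaximalIdeal_of_mem_shiftedPart {m j : ℕ} (h : m ≠ j) {a : A}
    (ha : a ∈ shiftedPart 𝒜 m j) : a ∈ gradedMaximalIdeal 𝒜 := by
  rcases mem_shiftedPart_iff.1 ha with rfl | ⟨n, rfl, hn⟩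
  · exact zero_mem _
  · exact mem_gradedMaximalIdeal_of_mem (by omega) hn

section Free

variable {ι : Type v} {deg : ι → ℕ}

theorem mem_freeGrading_iff {j : ℕ} {x : ι →₀ A} :
    x ∈ freeGrading 𝒜 deg j ↔ ∀ e, x e ∈ shiftedPart 𝒜 (deg e) j := by
  simp only [freeGrading, Submodule.mem_iInf, Submodule.mem_comap]
  rfl

theorem single_mem_freeGrading {j : ℕ} {e : ι} {a : A} (ha : a ∈ shiftedPart 𝒜 (deg e) j) :
    Finsupp.single e a ∈ freeGrading 𝒜 deg j := by
  classical
  rw [mem_freeGrading_iff]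
  intro e'
  rw [Finsupp.single_apply]
  split_ifs with h
  · exact h ▸ ha
  · exact zero_mem _

theorem single_one_mem_freeGrading [SetLike.GradedOne 𝒜] (e : ι) :
    Finsupp.single e 1 ∈ freeGrading 𝒜 deg (deg e) :=
  single_mem_freeGrading (mem_shiftedPart_add (n := 0) (SetLike.GradedOne.one_mem (A := 𝒜)))

variable [GradedAlgebra 𝒜]

variable (𝒜 deg) in
/-- The map decomposing an element of a graded free module into homogeneous components. -/
noncomputable def freeDecompose : (ι →₀ A) →ₗ[k] DirectSum ℕ fun j => freeGrading 𝒜 deg j :=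
  Finsupp.lsum k fun e =>
    (DirectSum.toModule k ℕ (DirectSum ℕ (freeGrading 𝒜 deg ·)) fun n =>
      DirectSum.lof k ℕ (fun j => freeGrading 𝒜 deg j) (deg e + n) ∘ₗ
        (Finsupp.lsingle e : A →ₗ[k] (ι →₀ A)).restrict fun _ ha =>
          single_mem_freeGrading (mem_shiftedPart_add ha)) ∘ₗ
      (DirectSum.decomposeLinearEquiv 𝒜).toLinearMap

theorem freeDecompose_single {e : ι} {n : ℕ} {a : A} (ha : a ∈ 𝒜 n) :
    freeDecompose 𝒜 deg (Finsupp.single e a) =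
      DirectSum.lof k ℕ (fun j => freeGrading 𝒜 deg j) (deg e + n)
        ⟨Finsupp.single e a, single_mem_freeGrading (mem_shiftedPart_add ha)⟩ := by
  rw [freeDecompose, Finsupp.lsum_single, LinearMap.comp_apply, LinearEquiv.coe_coe,
    DirectSum.decomposeLinearEquiv_apply, DirectSum.decompose_of_mem 𝒜 ha,
    ← DirectSum.lof_eq_of k, DirectSum.toModule_lof]
  rfl

theorem freeDecompose_coe {j : ℕ} (x : freeGrading 𝒜 deg j) :
    freeDecompose 𝒜 deg (x : ι →₀ A) = DirectSum.lof k ℕ (fun j => freeGrading 𝒜 deg j) j x := by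
  obtain ⟨x, hx⟩ := x
  have hx' := mem_freeGrading_iff.1 hx
  have h_single (e : ι) : freeDecompose 𝒜 deg (Finsupp.single e (x e)) =
      DirectSum.lof k ℕ (fun j => freeGrading 𝒜 deg j) j
        ⟨Finsupp.single e (x e), single_mem_freeGrading (hx' e)⟩ := by
    rcases mem_shiftedPart_iff.1 (hx' e) with h | ⟨n, rfl, hn⟩
    · simp_rw [h, Finsupp.single_zero]
      exact (map_zero _).trans (map_zero _).symm
    · exact freeDecompose_single hn
  have h_sum : (⟨x, hx⟩ : freeGrading 𝒜 deg j) =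
      ∑ e ∈ x.support, ⟨Finsupp.single e (x e), single_mem_freeGrading (hx' e)⟩ := by
    apply Subtype.ext
    rw [AddSubmonoidClass.coe_finsetSum]
    exact x.sum_single.symm
  rw [h_sum, map_sum, AddSubmonoidClass.coe_finsetSum, map_sum]
  exact Finset.sum_congr rfl fun e _ => h_single e

noncomputable instance freeGrading_decomposition :
    DirectSum.Decomposition (freeGrading 𝒜 deg) :=
  DirectSum.Decomposition.ofLinearMap _ (freeDecompose 𝒜 deg)
    (by
      refine Finsupp.lhom_ext fun e a => ?_
      induction a using DirectSum.Decomposition.inductionOn 𝒜 with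
      | zero => simp
      | homogeneous a =>
        rw [LinearMap.comp_apply, freeDecompose_single a.2, DirectSum.coeLinearMap_lof]
        rfl
      | add a b ha hb => rw [Finsupp.single_add, map_add, map_add, ha, hb])
    (by
      ext j x
      rw [LinearMap.comp_apply, LinearMap.comp_apply, DirectSum.coeLinearMap_lof, freeDecompose_coe]
      rfl)

instance freeGrading_gradedSMul : SetLike.GradedSMul 𝒜 (freeGrading 𝒜 deg) where
  smul_mem {i j a x} ha hx := by
    rw [mem_freeGrading_iff] at hx ⊢
    intro e
    rcases mem_shiftedPart_iff.1 (hx e) with h | ⟨n, rfl, hn⟩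
    · simp [h]
    · refine mem_shiftedPart_iff.2 (Or.inr ⟨i + n, ?_, SetLike.GradedMul.mul_mem ha hn⟩)
      rw [vadd_eq_add]
      omega

end Free

section GradedModule

variable {M : Type*} [AddCommGroup M] [Module A M] [Module k M] {ℳ : ℕ → Submodule k M}

theorem map_mem_of_mem_freeGrading [SetLike.GradedSMul 𝒜 ℳ] {ι : Type v} {deg : ι → ℕ}
    {f : (ι →₀ A) →ₗ[A] M} (hf : ∀ e, f (Finsupp.single e 1) ∈ ℳ (deg e)) {j : ℕ} {x : ι →₀ A}
    (hx : x ∈ freeGrading 𝒜 deg j) : f x ∈ ℳ j := by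
  rw [← x.sum_single, Finsupp.sum, map_sum]
  refine Submodule.sum_mem _ fun e _ => ?_
  rw [← mul_one (x e), ← smul_eq_mul, ← Finsupp.smul_single, map_smul]
  rcases mem_shiftedPart_iff.1 (mem_freeGrading_iff.1 hx e) with h | ⟨n, rfl, hn⟩
  · simp [h]
  · rw [add_comm]
    exact SetLike.GradedSMul.smul_mem (A := 𝒜) (B := ℳ) hn (hf e)

variable [GradedAlgebra 𝒜] [DirectSum.Decomposition ℳ] [SetLike.GradedSMul 𝒜 ℳ]

section GradedMap

variable {ι : Type v} {deg : ι → ℕ} {f : (ι →₀ A) →ₗ[A] M}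

theorem decompose_map (hf : ∀ e, f (Finsupp.single e 1) ∈ ℳ (deg e)) (x : ι →₀ A) (j : ℕ) :
    (DirectSum.decompose ℳ (f x) j : M) =
      f (DirectSum.decompose (freeGrading 𝒜 deg) x j : ι →₀ A) := by
  induction x using DirectSum.Decomposition.inductionOn (freeGrading 𝒜 deg) with
  | zero => simp
  | @homogeneous n x =>
    have h := map_mem_of_mem_freeGrading hf x.2
    obtain rfl | hn := eq_or_ne n j
    · rw [DirectSum.decompose_of_mem_same _ h, DirectSum.decompose_of_mem_same _ x.2]
    · rw [DirectSum.decompose_of_mem_ne _ h hn, DirectSum.decompose_of_mem_ne _ x.2 hn, map_zero]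
  | add x y hx hy => simp [DirectSum.decompose_add, hx, hy]

variable (𝒜) in
theorem exists_mem_freeGrading_map_eq (hf : ∀ e, f (Finsupp.single e 1) ∈ ℳ (deg e)) {y : M} {j : ℕ}
    (hyj : y ∈ ℳ j) (hy : y ∈ LinearMap.range f) : ∃ x ∈ freeGrading 𝒜 deg j, f x = y := by
  obtain ⟨x, rfl⟩ := hy
  exact ⟨_, (DirectSum.decompose (freeGrading 𝒜 deg) x j).2,
    by rw [← decompose_map hf, DirectSum.decompose_of_mem_same _ hyj]⟩

variable (𝒜) in
theorem exists_graded_lift (hf : ∀ e, f (Finsupp.single e 1) ∈ ℳ (deg e)) {κ : Type v}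
    {deg' : κ → ℕ} {g : (κ →₀ A) →ₗ[A] M} (hg : ∀ e, g (Finsupp.single e 1) ∈ ℳ (deg' e))
    (h : LinearMap.range f ≤ LinearMap.range g) :
    ∃ φ : (ι →₀ A) →ₗ[A] (κ →₀ A), g ∘ₗ φ = f ∧
      ∀ e, φ (Finsupp.single e 1) ∈ freeGrading 𝒜 deg' (deg e) := by
  choose y hy hgy using fun e => exists_mem_freeGrading_map_eq 𝒜 hg (hf e) (h ⟨_, rfl⟩)
  refine ⟨Finsupp.linearCombination A y, ?_, fun e => ?_⟩
  · ext e
    simp [hgy]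
  · simpa using hy e

variable (𝒜) in
theorem ker_isHomogeneous (hf : ∀ e, f (Finsupp.single e 1) ∈ ℳ (deg e)) :
    (LinearMap.ker f).IsHomogeneous (freeGrading 𝒜 deg) := by
  intro j x hx
  have hx : f x = 0 := hx
  change f _ = 0
  rw [← decompose_map hf, hx]
  simp

variable (𝒜) in
include 𝒜 in
theorem range_isHomogeneous (hf : ∀ e, f (Finsupp.single e 1) ∈ ℳ (deg e)) :
    (LinearMap.range f).IsHomogeneous ℳ := by
  rintro j _ ⟨x, rfl⟩
  exact ⟨_, (decompose_map (𝒜 := 𝒜) hf x j).symm⟩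

end GradedMap

theorem decompose_mem_smul_span_of_mem_smul {K : Submodule A M} (hK : K.IsHomogeneous ℳ) {x : M}
    (hx : x ∈ gradedMaximalIdeal 𝒜 • K) (j : ℕ) :
    (DirectSum.decompose ℳ x j : M) ∈
      gradedMaximalIdeal 𝒜 • Submodule.span A {y | y ∈ K ∧ ∃ l < j, y ∈ ℳ l} := by
  classical
  induction hx using Submodule.smul_induction_on' with
  | smul a ha y hy =>
    rw [← DirectSum.sum_support_decompose 𝒜 a, Finset.sum_smul, DirectSum.decompose_sum,
      DFinsupp.finsetSum_apply, AddSubmonoidClass.coe_finsetSum]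
    refine Submodule.sum_mem _ fun n _ => ?_
    rw [← DirectSum.sum_support_decompose ℳ y, Finset.smul_sum, DirectSum.decompose_sum,
      DFinsupp.finsetSum_apply, AddSubmonoidClass.coe_finsetSum]
    refine Submodule.sum_mem _ fun l _ => ?_
    have hmem := SetLike.GradedSMul.smul_mem (A := 𝒜) (B := ℳ)
      (DirectSum.decompose 𝒜 a n).2 (DirectSum.decompose ℳ y l).2
    rw [vadd_eq_add] at hmem
    obtain rfl | hj := eq_or_ne (n + l) j
    · rw [DirectSum.decompose_of_mem_same _ hmem]
      rcases Nat.eq_zero_or_pos n with rfl | hn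
      · rw [(mem_gradedMaximalIdeal_iff 𝒜).1 ha, zero_smul]
        exact zero_mem _
      · exact Submodule.smul_mem_smul
          (mem_gradedMaximalIdeal_of_mem hn (DirectSum.decompose 𝒜 a n).2)
          (Submodule.subset_span ⟨hK l hy, l, by omega, (DirectSum.decompose ℳ y l).2⟩)
    · rw [DirectSum.decompose_of_mem_ne _ hmem hj]
      exact zero_mem _
  | add y _ z _ hy hz =>
    rw [DirectSum.decompose_add, DirectSum.add_apply, Submodule.coe_add]
    exact add_mem hy hz

/-- A form of the graded Nakayama lemma which needs no finiteness, because degrees are bounded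
below. -/
theorem le_of_le_sup_gradedMaximalIdeal_smul {K L : Submodule A M} (hK : K.IsHomogeneous ℳ)
    (hL : L.IsHomogeneous ℳ) (h : K ≤ L ⊔ gradedMaximalIdeal 𝒜 • K) : K ≤ L := by
  classical
  have h_part (j : ℕ) : ∀ x ∈ K, x ∈ ℳ j → x ∈ L := by
    induction j using Nat.strong_induction_on with
    | _ j ih =>
      intro x hx hxj
      obtain ⟨y, hy, z, hz, rfl⟩ := Submodule.mem_sup.1 (h hx)
      rw [← DirectSum.decompose_of_mem_same ℳ hxj, DirectSum.decompose_add, DirectSum.add_apply,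
        Submodule.coe_add]
      refine add_mem (hL j hy) (Submodule.smul_le_right.trans (Submodule.span_le.2 ?_)
        (decompose_mem_smul_span_of_mem_smul hK hz j))
      rintro w ⟨hw, l, hl, hwl⟩
      exact ih l hl w hw hwl
  intro x hx
  rw [← DirectSum.sum_support_decompose ℳ x]
  exact Submodule.sum_mem _ fun j _ => h_part j _ (hK j hx) (DirectSum.decompose ℳ x j).2

theorem eq_bot_of_le_gradedMaximalIdeal_smul {K : Submodule A M} (hK : K.IsHomogeneous ℳ)
    (h : K ≤ gradedMaximalIdeal 𝒜 • K) : K = ⊥ := by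
  refine eq_bot_iff.2 (le_of_le_sup_gradedMaximalIdeal_smul (𝒜 := 𝒜) hK ?_ (h.trans le_sup_right))
  rintro j x (rfl : x = 0)
  simp

end GradedModule

end GradedFree

section MinimalResolution

variable {k : Type u} [Field k] {A : Type v} [CommRing A] [Algebra k A]
  {𝒜 : ℕ → Submodule k A} [GradedAlgebra 𝒜]

section MinimalCover

variable {M : Type v} [AddCommGroup M] [Module A M] [Module k M] [IsScalarTower k A M]
  {ℳ : ℕ → Submodule k M}

theorem exists_minimal_homogeneous_generators [DirectSum.Decomposition ℳ]
    [SetLike.GradedSMul 𝒜 ℳ] {K : Submodule A M} (hK : K.IsHomogeneous ℳ) :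
    ∃ (ι : Type v) (deg : ι → ℕ) (b : ι → M), (∀ e, b e ∈ ℳ (deg e)) ∧
      Submodule.span A (Set.range b) = K ∧
      LinearIndependent k fun e => (gradedMaximalIdeal 𝒜 • K).mkQ (b e) := by
  classical
  let π := (gradedMaximalIdeal 𝒜 • K).mkQ
  let v : (Σ j, ↥(K.restrictScalars k ⊓ ℳ j)) → M ⧸ gradedMaximalIdeal 𝒜 • K := fun e => π e.2
  obtain ⟨ι, a, -, hspan, hli⟩ := exists_linearIndependent' k v
  let b : ι → M := fun e => (a e).2
  have hbK : Submodule.span A (Set.range b) ≤ K :=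
    Submodule.span_le.2 (Set.range_subset_iff.2 fun e => (a e).2.2.1)
  have hb (e : ι) : b e ∈ ℳ (a e).1 := (a e).2.2.2
  have h_range : LinearMap.range (Finsupp.linearCombination A b) = Submodule.span A (Set.range b) :=
    Finsupp.range_linearCombination A
  have h_hom : (Submodule.span A (Set.range b)).IsHomogeneous ℳ :=
    h_range ▸ range_isHomogeneous 𝒜 (deg := fun e => (a e).1) fun e => by
      rw [Finsupp.linearCombination_single, one_smul]
      exact hb e
  refine ⟨ι, fun e => (a e).1, b, hb, le_antisymm hbK ?_, hli⟩
  refine le_of_le_sup_gradedMaximalIdeal_smul (𝒜 := 𝒜) hK h_hom fun x hx => ?_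
  rw [sup_comm, ← Submodule.comap_map_mkQ, Submodule.mem_comap,
    ← DirectSum.sum_support_decompose ℳ x, map_sum]
  refine Submodule.sum_mem _ fun j _ => ?_
  have hv : π (DirectSum.decompose ℳ x j) ∈ Submodule.span k (Set.range v) :=
    Submodule.subset_span ⟨⟨j, _, hK j hx, (DirectSum.decompose ℳ x j).2⟩, rfl⟩
  rw [← hspan] at hv
  have h_le : Submodule.span k (Set.range (v ∘ a)) ≤
      ((Submodule.span A (Set.range b)).map π).restrictScalars k :=
    Submodule.span_le.2 (Set.range_subset_iff.2 fun e =>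
      ⟨b e, Submodule.subset_span (Set.mem_range_self e), rfl⟩)
  exact h_le hv

theorem mem_smul_top_of_linearIndependent_mkQ (h0 : 𝒜 0 = (⊥ : Subalgebra k A).toSubmodule)
    {ι : Type*} {b : ι → M} {K : Submodule A M} (hbK : ∀ e, b e ∈ K)
    (hb : LinearIndependent k fun e => (gradedMaximalIdeal 𝒜 • K).mkQ (b e)) {x : ι →₀ A}
    (hx : Finsupp.linearCombination A b x ∈ gradedMaximalIdeal 𝒜 • K) :
    x ∈ gradedMaximalIdeal 𝒜 • (⊤ : Submodule A (ι →₀ A)) := by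
  choose c hc using exists_sub_algebraMap_mem_gradedMaximalIdeal h0
  have h_sum : ∑ e ∈ x.support, c (x e) • (gradedMaximalIdeal 𝒜 • K).mkQ (b e) = 0 := by
    have h_sub : ∑ e ∈ x.support, (x e - algebraMap k A (c (x e))) • b e ∈
        gradedMaximalIdeal 𝒜 • K :=
      Submodule.sum_mem _ fun e _ => Submodule.smul_mem_smul (hc _) (hbK e)
    simp only [sub_smul, Finset.sum_sub_distrib, algebraMap_smul] at h_sub
    rw [Finsupp.linearCombination_apply, Finsupp.sum] at hx
    have h_mem := (Submodule.sub_mem_iff_right _ hx).1 h_sub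
    rw [← Submodule.Quotient.mk_eq_zero, ← Submodule.mkQ_apply, map_sum] at h_mem
    exact h_mem
  refine mem_smul_top_finsupp_iff.2 fun e => ?_
  by_cases he : e ∈ x.support
  · simpa [linearIndependent_iff'.1 hb _ _ h_sum e he] using hc (x e)
  · rw [Finsupp.notMem_support_iff.1 he]
    exact zero_mem _

theorem exists_minimal_cover (h0 : 𝒜 0 = (⊥ : Subalgebra k A).toSubmodule)
    [DirectSum.Decomposition ℳ] [SetLike.GradedSMul 𝒜 ℳ]
    {K : Submodule A M} (hK : K.IsHomogeneous ℳ) :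
    ∃ (ι : Type v) (deg : ι → ℕ) (f : (ι →₀ A) →ₗ[A] M),
      (∀ e, f (Finsupp.single e 1) ∈ ℳ (deg e)) ∧ LinearMap.range f = K ∧
        LinearMap.ker f ≤ gradedMaximalIdeal 𝒜 • ⊤ := by
  obtain ⟨ι, deg, b, hdeg, rfl, hli⟩ := exists_minimal_homogeneous_generators (𝒜 := 𝒜) hK
  refine ⟨ι, deg, Finsupp.linearCombination A b, fun e => by simpa using hdeg e,
    Finsupp.range_linearCombination A, fun x hx => ?_⟩
  refine mem_smul_top_of_linearIndependent_mkQ h0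
    (fun e => Submodule.subset_span (Set.mem_range_self e)) hli ?_
  rw [LinearMap.mem_ker.1 hx]
  exact zero_mem _

end MinimalCover

variable (𝒜) in
/-- A graded free module with a homogeneous submodule: the state of the recursion which constructs
a free resolution by covering the syzygies one after the other. -/
structure HomogeneousSyzygy where
  ι : Type v
  deg : ι → ℕ
  module : Submodule A (ι →₀ A)
  isHomogeneous : module.IsHomogeneous (freeGrading 𝒜 deg)

theorem HomogeneousSyzygy.exists_next (h0 : 𝒜 0 = (⊥ : Subalgebra k A).toSubmodule)
    (Z : HomogeneousSyzygy 𝒜) :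
    ∃ (Z' : HomogeneousSyzygy 𝒜) (f : (Z'.ι →₀ A) →ₗ[A] (Z.ι →₀ A)),
      (∀ e, f (Finsupp.single e 1) ∈ freeGrading 𝒜 Z.deg (Z'.deg e)) ∧
      LinearMap.range f = Z.module ∧ LinearMap.ker f = Z'.module ∧
      Z'.module ≤ gradedMaximalIdeal 𝒜 • ⊤ := by
  obtain ⟨ι, deg, f, hdeg, hrange, hker⟩ := exists_minimal_cover h0 Z.isHomogeneous
  exact ⟨⟨ι, deg, LinearMap.ker f, ker_isHomogeneous 𝒜 hdeg⟩, f, hdeg, hrange, rfl, hker⟩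

namespace GradedFreeResolution

variable {M : Type v} [AddCommGroup M] [Module A M] [Module k M] [IsScalarTower k A M]
  {ℳ : ℕ → Submodule k M}

/-- A graded free resolution is minimal if its differentials have entries in the maximal ideal,
that is, vanish modulo `𝔪`. -/
def IsMinimal {𝒜 : ℕ → Submodule k A} (F : GradedFreeResolution 𝒜 ℳ) : Prop :=
  ∀ i x, F.d i x ∈ gradedMaximalIdeal 𝒜 • (⊤ : Submodule A (F.ι i →₀ A))

theorem exists_isMinimal (h0 : 𝒜 0 = (⊥ : Subalgebra k A).toSubmodule)
    [DirectSum.Decomposition ℳ] [SetLike.GradedSMul 𝒜 ℳ] :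
    ∃ F : GradedFreeResolution 𝒜 ℳ, F.IsMinimal := by
  obtain ⟨ι, deg, f, hdeg, hrange, hker⟩ :=
    exists_minimal_cover (𝒜 := 𝒜) (ℳ := ℳ) (K := ⊤) h0 fun _ _ _ => trivial
  choose next d hd_deg hd_range hd_ker hd_min using HomogeneousSyzygy.exists_next (𝒜 := 𝒜) h0
  let Z : ℕ → HomogeneousSyzygy 𝒜 := fun n =>
    Nat.rec ⟨ι, deg, LinearMap.ker f, ker_isHomogeneous 𝒜 hdeg⟩ (fun _ => next) n
  refine ⟨{ ι := fun n => (Z n).ι, deg := fun n => (Z n).deg, d := fun n => d (Z n), aug := f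
            d_homogeneous := fun n => hd_deg (Z n)
            aug_homogeneous := hdeg
            exact_succ := fun n => LinearMap.exact_iff.2 ?_
            exact_zero := LinearMap.exact_iff.2 (hd_range (Z 0)).symm
            aug_surjective := LinearMap.range_eq_top.1 hrange }, fun n x => ?_⟩
  · exact (hd_ker (Z n)).trans (hd_range (Z (n + 1))).symm
  · have hx : d (Z n) x ∈ (Z n).module := hd_range (Z n) ▸ ⟨x, rfl⟩
    cases n with
    | zero => exact hker hx
    | succ n => exact hd_min (Z n) hx

end GradedFreeResolution

section IdealGrading

instance idealGrading_gradedSMul (I : Ideal A) : SetLike.GradedSMul 𝒜 (idealGrading 𝒜 I) where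
  smul_mem {_ _ _ _} ha hx := SetLike.GradedMul.mul_mem (A := 𝒜) ha hx

theorem isInternal_idealGrading {I : Ideal A} (hI : I.IsHomogeneous 𝒜) :
    DirectSum.IsInternal (idealGrading 𝒜 I) := by
  classical
  refine DirectSum.isInternal_submodule_of_iSupIndep_of_iSup_eq_top ?_ (eq_top_iff.2 fun x _ => ?_)
  · have h_indep := iSupIndep_iff_finsetSum_eq_zero_imp_eq_zero 𝒜 |>.1
      (DirectSum.Decomposition.isInternal 𝒜).submodule_iSupIndep
    refine (iSupIndep_iff_finsetSum_eq_zero_imp_eq_zero _).2 fun s x hx hsum j hj => ?_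
    refine Subtype.ext (h_indep s (fun j => x j) hx ?_ j hj)
    rw [← AddSubmonoidClass.coe_finsetSum, hsum, Submodule.coe_zero]
  · have hx : x = ∑ j ∈ (DirectSum.decompose 𝒜 (x : A)).support,
        ⟨DirectSum.decompose 𝒜 (x : A) j, hI j x.2⟩ := by
      apply Subtype.ext
      rw [AddSubmonoidClass.coe_finsetSum]
      exact (DirectSum.sum_support_decompose 𝒜 _).symm
    rw [hx]
    exact Submodule.sum_mem _ fun j _ =>
      Submodule.mem_iSup_of_mem j (DirectSum.decompose 𝒜 (x : A) j).2

/-- The decomposition of a homogeneous ideal into its homogeneous parts. It is not an instance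
because it depends on a proof that the ideal is homogeneous. -/
noncomputable abbrev idealGradingDecomposition {I : Ideal A} (hI : I.IsHomogeneous 𝒜) :
    DirectSum.Decomposition (idealGrading 𝒜 I) :=
  (isInternal_idealGrading hI).chooseDecomposition

end IdealGrading

end MinimalResolution

section Tor

theorem homologicalComplex_hom_f_eq_zero {C : Type*} [Category* C] [Abelian C]
    {c : ComplexShape ℕ} {K L : HomologicalComplex C c} (φ : K ⟶ L) (hK : ∀ i j, K.d i j = 0)
    (hL : ∀ i j, L.d i j = 0) (n : ℕ) (h : HomologicalComplex.homologyMap φ n = 0) :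
    φ.f n = 0 := by
  have := K.isIso_iCycles n _ rfl (hK _ _)
  have := L.isIso_homologyπ _ n rfl (hL _ _)
  have h_naturality := HomologicalComplex.homologyπ_naturality φ n
  rw [h, Limits.comp_zero] at h_naturality
  have h_cycles : HomologicalComplex.cyclesMap φ n = 0 := by
    rw [← cancel_mono (L.homologyπ n), ← h_naturality, Limits.zero_comp]
  rw [← cancel_epi (K.iCycles n), ← HomologicalComplex.cyclesMap_i, h_cycles, Limits.zero_comp,
    Limits.comp_zero]

theorem lTensor_quotient_eq_zero_iff {A : Type*} [CommRing A] {m : Ideal A} {M N : Type*}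
    [AddCommGroup M] [Module A M] [AddCommGroup N] [Module A N] (f : M →ₗ[A] N) :
    f.lTensor (A ⧸ m) = 0 ↔ ∀ x, f x ∈ m • (⊤ : Submodule A N) := by
  have h_tmul (a : A) (x : M) : f.lTensor (A ⧸ m) (Ideal.Quotient.mk m a ⊗ₜ x) = 0 ↔
      a • f x ∈ m • (⊤ : Submodule A N) := by
    rw [LinearMap.lTensor_tmul, ← (TensorProduct.quotTensorEquivQuotSMul N m).map_eq_zero_iff,
      TensorProduct.quotTensorEquivQuotSMul_mk_tmul, Submodule.Quotient.mk_eq_zero]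
  constructor
  · intro h x
    simpa [h] using h_tmul 1 x
  · intro h
    refine TensorProduct.ext' fun a x => ?_
    obtain ⟨a, rfl⟩ := Ideal.Quotient.mk_surjective a
    exact (h_tmul a x).2 (Submodule.smul_mem _ _ (h x))

theorem map_tensoringLeft_quotient_eq_zero_iff {A : Type v} [CommRing A] {m : Ideal A}
    {M N : ModuleCat.{v} A} (f : M ⟶ N) :
    ((MonoidalCategory.tensoringLeft (ModuleCat.{v} A)).obj (ModuleCat.of A (A ⧸ m))).map f = 0 ↔
      ∀ x, f.hom x ∈ m • (⊤ : Submodule A N) := by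
  rw [← lTensor_quotient_eq_zero_iff]
  exact ⟨fun h => congrArg ModuleCat.Hom.hom h, fun h => ModuleCat.hom_ext h⟩

namespace GradedFreeResolution

variable {k : Type u} [Field k] {A : Type v} [CommRing A] [Algebra k A] {𝒜 : ℕ → Submodule k A}
  {M : Type v} [AddCommGroup M] [Module A M] [Module k M] [IsScalarTower k A M]
  {ℳ : ℕ → Submodule k M} (F : GradedFreeResolution 𝒜 ℳ)

/-- The chain complex of a graded free resolution. -/
noncomputable def complex : ChainComplex (ModuleCat.{v} A) ℕ :=
  ChainComplex.of (fun i => ModuleCat.of A (F.ι i →₀ A)) (fun i => ModuleCat.ofHom (F.d i))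
    fun i => ModuleCat.hom_ext (F.exact_succ i).linearMap_comp_eq_zero

theorem complex_d (i : ℕ) : F.complex.d (i + 1) i = ModuleCat.ofHom (F.d i) :=
  ChainComplex.of_d (fun i => ModuleCat.of A (F.ι i →₀ A)) (fun i => ModuleCat.ofHom (F.d i)) i

theorem complex_d_comp_aug :
    F.complex.d 1 0 ≫ (ModuleCat.ofHom F.aug : F.complex.X 0 ⟶ ModuleCat.of A M) = 0 := by
  rw [complex_d]
  exact ModuleCat.hom_ext F.exact_zero.linearMap_comp_eq_zero

theorem complex_exactAt_succ (n : ℕ) : F.complex.ExactAt (n + 1) := by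
  rw [HomologicalComplex.exactAt_iff' _ (n + 1 + 1) (n + 1) n (by simp) (by simp),
    ShortComplex.moduleCat_exact_iff]
  intro x hx
  change F.complex.d (n + 1) n x = 0 at hx
  change ∃ y, F.complex.d (n + 2) (n + 1) y = x
  rw [complex_d] at hx ⊢
  exact (F.exact_succ n x).1 hx

/-- A graded free resolution as a projective resolution, used to compare the explicit resolution
with the derived functor `Tor`. -/
noncomputable def projectiveResolution : ProjectiveResolution (ModuleCat.of A M) where
  complex := F.complex
  projective i := inferInstanceAs (Projective (ModuleCat.of A (F.ι i →₀ A)))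
  π := (ChainComplex.toSingle₀Equiv _ _).symm ⟨ModuleCat.ofHom F.aug, F.complex_d_comp_aug⟩
  quasiIso := ⟨fun n => by
    cases n with
    | zero =>
      rw [ChainComplex.quasiIsoAt₀_iff, ShortComplex.quasiIso_iff_of_zeros' _ rfl rfl rfl]
      refine (ShortComplex.exact_and_epi_g_iff_of_iso
        (S₂ := ShortComplex.mk (F.complex.d 1 0) (ModuleCat.ofHom F.aug) F.complex_d_comp_aug)
        (ShortComplex.isoMk (Iso.refl _) (Iso.refl _) (Iso.refl _)
          ((Category.id_comp _).trans (Category.comp_id _).symm)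
          ((Category.id_comp _).trans (Category.comp_id _).symm))).2
        ⟨?_, (ModuleCat.epi_iff_surjective _).2 F.aug_surjective⟩
      rw [ShortComplex.moduleCat_exact_iff]
      intro x hx
      change ∃ y, F.complex.d 1 0 y = x
      rw [complex_d]
      exact (F.exact_zero x).1 hx
    | succ n =>
      rw [quasiIsoAt_iff_exactAt']
      · exact F.complex_exactAt_succ n
      · exact ChainComplex.exactAt_succ_single_obj _ _⟩

theorem projectiveResolution_π_f_zero :
    F.projectiveResolution.π.f 0 = ModuleCat.ofHom F.aug :=
  ChainComplex.toSingle₀Equiv_symm_apply_f_zero _ _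

theorem IsMinimal.map_tensoringLeft_d_eq_zero {F : GradedFreeResolution 𝒜 ℳ} (hF : F.IsMinimal)
    (i j : ℕ) :
    ((MonoidalCategory.tensoringLeft (ModuleCat.{v} A)).obj
      (ModuleCat.of A (A ⧸ gradedMaximalIdeal 𝒜))).map (F.complex.d i j) = 0 := by
  obtain rfl | hij := eq_or_ne (j + 1) i
  · rw [complex_d]
    exact (map_tensoringLeft_quotient_eq_zero_iff _).2 (hF j)
  · rw [F.complex.shape i j hij, Functor.map_zero]

end GradedFreeResolution

end Tor

namespace GradedFreeResolution

section Comparison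

variable {k : Type u} [Field k] {A : Type v} [CommRing A] [Algebra k A] {𝒜 : ℕ → Submodule k A}
  {M N : Type v} [AddCommGroup M] [Module A M] [Module k M] [IsScalarTower k A M]
  [AddCommGroup N] [Module A N] [Module k N] [IsScalarTower k A N]
  {ℳ : ℕ → Submodule k M} {𝒩 : ℕ → Submodule k N}

/-- The maps `φ i : F_i → G_i` preserve degrees and form a chain map of resolutions lifting the
map `f` of the resolved modules. -/
structure IsLift (F : GradedFreeResolution 𝒜 ℳ) (G : GradedFreeResolution 𝒜 𝒩) (f : M →ₗ[A] N)
    (φ : ∀ i, (F.ι i →₀ A) →ₗ[A] (G.ι i →₀ A)) : Prop where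
  graded : ∀ i e, φ i (Finsupp.single e 1) ∈ freeGrading 𝒜 (G.deg i) (F.deg i e)
  comm : ∀ i x, G.d i (φ (i + 1) x) = φ i (F.d i x)
  aug : ∀ x, G.aug (φ 0 x) = f (F.aug x)

variable {F : GradedFreeResolution 𝒜 ℳ} {G : GradedFreeResolution 𝒜 𝒩} {f : M →ₗ[A] N}
  {φ ψ : ∀ i, (F.ι i →₀ A) →ₗ[A] (G.ι i →₀ A)}

theorem exists_isLift [GradedAlgebra 𝒜] [DirectSum.Decomposition 𝒩] [SetLike.GradedSMul 𝒜 𝒩]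
    (F : GradedFreeResolution 𝒜 ℳ) (G : GradedFreeResolution 𝒜 𝒩)
    (hf : ∀ j, ∀ x ∈ ℳ j, f x ∈ 𝒩 j) : ∃ φ, F.IsLift G f φ := by
  let Q (i : ℕ) (φ : (F.ι i →₀ A) →ₗ[A] (G.ι i →₀ A)) : Prop :=
    (∀ e, φ (Finsupp.single e 1) ∈ freeGrading 𝒜 (G.deg i) (F.deg i e)) ∧
      LinearMap.range (φ ∘ₗ F.d i) ≤ LinearMap.range (G.d i)
  have h_zero : ∃ φ : {φ // Q 0 φ}, G.aug ∘ₗ φ.1 = f ∘ₗ F.aug := by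
    obtain ⟨φ, h_aug, h_graded⟩ := exists_graded_lift 𝒜 (f := f ∘ₗ F.aug)
      (fun e => hf _ _ (F.aug_homogeneous e)) G.aug_homogeneous
      ((LinearMap.range_eq_top.2 G.aug_surjective).ge.trans' le_top)
    refine ⟨⟨φ, h_graded, ?_⟩, h_aug⟩
    rw [← LinearMap.exact_iff.1 G.exact_zero, LinearMap.range_le_ker_iff, ← LinearMap.comp_assoc,
      h_aug, LinearMap.comp_assoc, F.exact_zero.linearMap_comp_eq_zero, LinearMap.comp_zero]
  have h_succ (i : ℕ) (φ : {φ // Q i φ}) :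
      ∃ φ' : {φ // Q (i + 1) φ}, G.d i ∘ₗ φ'.1 = φ.1 ∘ₗ F.d i := by
    obtain ⟨φ', h_comm, h_graded⟩ := exists_graded_lift 𝒜 (f := φ.1 ∘ₗ F.d i)
      (fun e => map_mem_of_mem_freeGrading φ.2.1 (F.d_homogeneous i e)) (G.d_homogeneous i) φ.2.2
    refine ⟨⟨φ', h_graded, ?_⟩, h_comm⟩
    rw [← LinearMap.exact_iff.1 (G.exact_succ i), LinearMap.range_le_ker_iff,
      ← LinearMap.comp_assoc, h_comm, LinearMap.comp_assoc,
      (F.exact_succ i).linearMap_comp_eq_zero, LinearMap.comp_zero]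
  obtain ⟨φ₀, hφ₀⟩ := h_zero
  choose next hnext using h_succ
  let Φ (i : ℕ) : {φ // Q i φ} := Nat.rec φ₀ next i
  exact ⟨fun i => (Φ i).1, fun i => (Φ i).2.1, fun i => LinearMap.congr_fun (hnext i (Φ i)),
    LinearMap.congr_fun hφ₀⟩

namespace IsLift

theorem id [SetLike.GradedOne 𝒜] (F : GradedFreeResolution 𝒜 ℳ) :
    F.IsLift F LinearMap.id fun _ => LinearMap.id where
  graded _ := single_one_mem_freeGrading
  comm _ _ := rfl
  aug _ := rfl

theorem comp [GradedAlgebra 𝒜] {P : Type v} [AddCommGroup P] [Module A P] [Module k P]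
    [IsScalarTower k A P] {𝒬 : ℕ → Submodule k P} {H : GradedFreeResolution 𝒜 𝒬} {g : N →ₗ[A] P}
    {χ : ∀ i, (G.ι i →₀ A) →ₗ[A] (H.ι i →₀ A)} (hχ : G.IsLift H g χ) (hφ : F.IsLift G f φ) :
    F.IsLift H (g ∘ₗ f) fun i => χ i ∘ₗ φ i where
  graded i e := map_mem_of_mem_freeGrading (hχ.graded i) (hφ.graded i e)
  comm i x := by simp [hχ.comm, hφ.comm]
  aug x := by simp [hχ.aug, hφ.aug]

/-- The morphism of chain complexes formed by a lift. -/
noncomputable def hom (hφ : F.IsLift G f φ) : F.complex ⟶ G.complex :=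
  ChainComplex.ofHom (fun i => ModuleCat.ofHom (φ i)) fun i => by
    rw [complex_d, complex_d]
    exact ModuleCat.hom_ext (LinearMap.ext (hφ.comm i))

theorem hom_f_comp_π_f (hφ : F.IsLift G f φ) :
    hφ.hom.f 0 ≫ G.projectiveResolution.π.f 0 =
      F.projectiveResolution.π.f 0 ≫ ModuleCat.ofHom f := by
  rw [projectiveResolution_π_f_zero, projectiveResolution_π_f_zero]
  exact ModuleCat.hom_ext (LinearMap.ext hφ.aug)

theorem hom_comp_π (hφ : F.IsLift G f φ) :
    hφ.hom ≫ G.projectiveResolution.π =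
      F.projectiveResolution.π ≫ (ChainComplex.single₀ _).map (ModuleCat.ofHom f) :=
  HomologicalComplex.to_single_hom_ext hφ.hom_f_comp_π_f

theorem sub_mem_boundaries (hφ : F.IsLift G f φ) (hψ : F.IsLift G f ψ) {i : ℕ} {x : F.ι i →₀ A}
    (hx : x ∈ F.cycles i) : φ i x - ψ i x ∈ G.boundaries i := by
  let h : Homotopy hφ.hom hψ.hom := ProjectiveResolution.liftHomotopy (P := F.projectiveResolution)
    (Q := G.projectiveResolution) (ModuleCat.ofHom f) _ _ hφ.hom_comp_π hψ.hom_comp_π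
  let φ' : (F.ι i →₀ A) →ₗ[A] (G.ι i →₀ A) := (dNext i h.hom).hom
  let ψ' : (F.ι i →₀ A) →ₗ[A] (G.ι (i + 1) →₀ A) := (h.hom i (i + 1)).hom
  have h_eq : φ i x = φ' x + G.d i (ψ' x) + ψ i x := by
    have h_comm := h.comm i
    rw [Homotopy.prevD_chainComplex, complex_d] at h_comm
    exact LinearMap.congr_fun (congrArg ModuleCat.Hom.hom h_comm) x
  have hφ' : φ' x ∈ gradedMaximalIdeal 𝒜 • (⊤ : Submodule A (G.ι i →₀ A)) := by
    cases i with
    | zero =>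
      have h_zero : φ' = 0 := congrArg ModuleCat.Hom.hom (Homotopy.dNext_zero_chainComplex h.hom)
      rw [h_zero]
      exact zero_mem _
    | succ i =>
      have h_succ : φ' = ModuleCat.Hom.hom (h.hom i (i + 1)) ∘ₗ F.d i := by
        have h_d := Homotopy.dNext_succ_chainComplex h.hom i
        rw [complex_d] at h_d
        exact congrArg ModuleCat.Hom.hom h_d
      rw [h_succ]
      exact Submodule.smul_top_le_comap_smul_top _ (ModuleCat.Hom.hom (h.hom i (i + 1))) hx
  rw [h_eq, add_sub_cancel_right]
  exact add_mem (Submodule.mem_sup_right hφ') (Submodule.mem_sup_left ⟨_, rfl⟩)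

end IsLift

variable (F) in
theorem exists_deg_eq_of_torDegree_ne_bot [GradedAlgebra 𝒜] [DirectSum.Decomposition ℳ]
    [SetLike.GradedSMul 𝒜 ℳ] {G : GradedFreeResolution 𝒜 ℳ} {i j : ℕ} (h : G.torDegree i j ≠ ⊥) :
    ∃ e : F.ι i, F.deg i e = j := by
  by_contra! hne
  obtain ⟨α, hα⟩ := exists_isLift (f := LinearMap.id) G F fun _ _ hx => hx
  obtain ⟨β, hβ⟩ := exists_isLift (f := LinearMap.id) F G fun _ _ hx => hx
  refine h (eq_bot_iff.2 ?_)
  rintro _ ⟨z, ⟨hz, hzj⟩, rfl⟩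
  change (G.boundaries i).mkQ z = 0
  rw [Submodule.mkQ_apply, Submodule.Quotient.mk_eq_zero]
  have hαz : α i z ∈ gradedMaximalIdeal 𝒜 • (⊤ : Submodule A (F.ι i →₀ A)) :=
    mem_smul_top_finsupp_iff.2 fun e => mem_gradedMaximalIdeal_of_mem_shiftedPart (hne e)
      (mem_freeGrading_iff.1 (map_mem_of_mem_freeGrading (hα.graded i) hzj) e)
  have hβα := Submodule.smul_top_le_comap_smul_top _ (β i) hαz
  have h_sub := (IsLift.id G).sub_mem_boundaries (hβ.comp hα) hz
  exact (Submodule.sub_mem_iff_left (G.boundaries i) (Submodule.mem_sup_right hβα)).1 h_sub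

theorem IsMinimal.torDegree_ne_bot [GradedAlgebra 𝒜] [Nontrivial A] (hF : F.IsMinimal) {i : ℕ}
    (e : F.ι i) : F.torDegree i (F.deg i e) ≠ ⊥ := by
  intro h
  have h_cycle : Finsupp.single e 1 ∈ F.cycles i := by
    cases i with
    | zero => trivial
    | succ i => exact hF i _
  have h_mem : (F.boundaries i).mkQ (Finsupp.single e 1) ∈ F.torDegree i (F.deg i e) :=
    ⟨_, ⟨h_cycle, single_one_mem_freeGrading e⟩, rfl⟩
  rw [h, Submodule.mem_bot, Submodule.mkQ_apply, Submodule.Quotient.mk_eq_zero] at h_mem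
  have h_le : F.boundaries i ≤ gradedMaximalIdeal 𝒜 • ⊤ :=
    sup_le (LinearMap.range_le_iff_comap.2 (eq_top_iff.2 fun x _ => hF i x)) le_rfl
  refine one_notMem_gradedMaximalIdeal 𝒜 ?_
  simpa using mem_smul_top_finsupp_iff.1 (h_le h_mem) e

theorem IsMinimal.regularity_eq [GradedAlgebra 𝒜] [Nontrivial A] [DirectSum.Decomposition ℳ]
    [SetLike.GradedSMul 𝒜 ℳ] (hF : F.IsMinimal) :
    regularity 𝒜 ℳ = sSup {x : EReal | ∃ (i : ℕ) (e : F.ι i),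
      x = (((F.deg i e : ℝ) - (i : ℝ) : ℝ) : EReal)} := by
  rw [regularity]
  congr 1
  ext x
  constructor
  · rintro ⟨i, j, ⟨G, hG⟩, rfl⟩
    obtain ⟨e, rfl⟩ := F.exists_deg_eq_of_torDegree_ne_bot hG
    exact ⟨i, e, rfl⟩
  · rintro ⟨i, e, rfl⟩
    exact ⟨i, _, ⟨F, hF.torDegree_ne_bot e⟩, rfl⟩

theorem IsLift.mem_smul_top_of_tor_map_eq_zero (hφ : F.IsLift G f φ) (hF : F.IsMinimal)
    (hG : G.IsMinimal) {i : ℕ}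
    (h : ((Tor (ModuleCat.{v} A) i).obj (ModuleCat.of A (A ⧸ gradedMaximalIdeal 𝒜))).map
      (ModuleCat.ofHom f) = 0) (x : F.ι i →₀ A) :
    φ i x ∈ gradedMaximalIdeal 𝒜 • (⊤ : Submodule A (G.ι i →₀ A)) := by
  let T := (MonoidalCategory.tensoringLeft (ModuleCat.{v} A)).obj
    (ModuleCat.of A (A ⧸ gradedMaximalIdeal 𝒜))
  have h_tor : (T.leftDerived i).map (ModuleCat.ofHom f) = 0 := h
  have h_iso := ProjectiveResolution.isoLeftDerivedObj_hom_naturality _ F.projectiveResolution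
    G.projectiveResolution hφ.hom hφ.hom_f_comp_π_f T i
  rw [h_tor, Limits.zero_comp, eq_comm, ← Limits.comp_zero, cancel_epi] at h_iso
  have h_f := homologicalComplex_hom_f_eq_zero ((T.mapHomologicalComplex _).map hφ.hom)
    hF.map_tensoringLeft_d_eq_zero hG.map_tensoringLeft_d_eq_zero i h_iso
  exact (map_tensoringLeft_quotient_eq_zero_iff (hφ.hom.f i)).1 h_f x

end Comparison

section ProjectiveDimension

variable {k : Type u} [Field k] {A : Type v} [CommRing A] [Algebra k A] {𝒜 : ℕ → Submodule k A}
  {M : Type v} [AddCommGroup M] [Module A M] [Module k M] [IsScalarTower k A M]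
  {ℳ : ℕ → Submodule k M} (F : GradedFreeResolution 𝒜 ℳ)

/-- The `i`-th syzygy of a resolution, as the cokernel of `F_{i+1} → F_i` rather than as the image
of `F_i` in the previous term, so that `i = 0` is not a special case. -/
noncomputable def syzygy (i : ℕ) : ModuleCat.{v} A :=
  ModuleCat.of A ((F.ι i →₀ A) ⧸ LinearMap.range (F.d i))

/-- The zeroth syzygy is the resolved module. -/
noncomputable def syzygyZeroIso : F.syzygy 0 ≅ ModuleCat.of A M :=
  ((Submodule.quotEquivOfEq _ _ (LinearMap.exact_iff.1 F.exact_zero).symm).trans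
    (F.aug.quotKerEquivOfSurjective F.aug_surjective)).toModuleIso

theorem hasProjectiveDimensionLT_syzygy_add_two_iff (i n : ℕ) :
    HasProjectiveDimensionLT (F.syzygy i) (n + 2) ↔
      HasProjectiveDimensionLT (F.syzygy (i + 1)) (n + 1) := by
  let ι : (F.ι (i + 1) →₀ A) ⧸ LinearMap.range (F.d (i + 1)) →ₗ[A] (F.ι i →₀ A) :=
    (LinearMap.range (F.d (i + 1))).liftQ (F.d i) (LinearMap.exact_iff.1 (F.exact_succ i)).ge
  have h_exact : Function.Exact ι (LinearMap.range (F.d i)).mkQ := by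
    rw [LinearMap.exact_iff, Submodule.ker_mkQ, Submodule.range_liftQ]
  have h_inj : Function.Injective ι := LinearMap.ker_eq_bot.1
    (Submodule.ker_liftQ_eq_bot _ _ _ (LinearMap.exact_iff.1 (F.exact_succ i)).le)
  exact (ModuleCat.shortComplex_shortExact
    (ShortComplex.mk (ModuleCat.ofHom ι) (ModuleCat.ofHom (LinearMap.range (F.d i)).mkQ)
      (ModuleCat.hom_ext h_exact.linearMap_comp_eq_zero)) h_exact h_inj
    (Submodule.mkQ_surjective _)).hasProjectiveDimensionLT_X₃_iff n
      (inferInstanceAs (Projective (ModuleCat.of A (F.ι i →₀ A))))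

theorem hasProjectiveDimensionLT_syzygy_iff (i n : ℕ) :
    HasProjectiveDimensionLT (F.syzygy i) (n + 1) ↔ Projective (F.syzygy (i + n)) := by
  induction n generalizing i with
  | zero => exact projective_iff_hasProjectiveDimensionLT_one.symm
  | succ n ih =>
    rw [hasProjectiveDimensionLT_syzygy_add_two_iff, ih, Nat.add_right_comm, Nat.add_assoc]

theorem hasProjectiveDimensionLT_succ_iff (n : ℕ) :
    HasProjectiveDimensionLT (ModuleCat.of A M) (n + 1) ↔ Projective (F.syzygy n) := by
  have h := F.hasProjectiveDimensionLT_syzygy_iff 0 n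
  rw [Nat.zero_add] at h
  exact ⟨fun _ => h.1 (hasProjectiveDimensionLT_of_iso F.syzygyZeroIso.symm _), fun hn =>
    have := h.2 hn
    hasProjectiveDimensionLT_of_iso F.syzygyZeroIso _⟩

theorem projective_syzygy_of_isEmpty {n : ℕ} [IsEmpty (F.ι (n + 1))] :
    Projective (F.syzygy n) := by
  have h_bot : LinearMap.range (F.d n) = ⊥ := LinearMap.range_eq_bot.2 (Subsingleton.elim _ _)
  have := Module.Projective.of_equiv (Submodule.quotEquivOfEqBot _ h_bot).symm
  exact (IsProjective.iff_projective _).1 this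

variable {F} [GradedAlgebra 𝒜]

theorem IsMinimal.isEmpty_of_projective_syzygy [Nontrivial A] (hF : F.IsMinimal) {n : ℕ}
    (h : Projective (F.syzygy n)) : IsEmpty (F.ι (n + 1)) := by
  let K := LinearMap.range (F.d n)
  have : Module.Projective A ((F.ι n →₀ A) ⧸ K) := (IsProjective.iff_projective _).2 h
  obtain ⟨s, hs⟩ := Module.projective_lifting_property K.mkQ LinearMap.id K.mkQ_surjective
  let π := LinearMap.id - s ∘ₗ K.mkQ
  have hπ_range : LinearMap.range π ≤ K := by
    rintro _ ⟨x, rfl⟩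
    rw [← K.ker_mkQ, LinearMap.mem_ker]
    exact (map_sub K.mkQ x _).trans (sub_eq_zero.2 (LinearMap.congr_fun hs (K.mkQ x)).symm)
  have hπ_id : ∀ x ∈ K, π x = x := fun x hx => by
    simp [π, (Submodule.Quotient.mk_eq_zero K).2 hx]
  have h_bot : K = ⊥ := by
    refine eq_bot_of_le_gradedMaximalIdeal_smul (𝒜 := 𝒜) (range_isHomogeneous 𝒜 (F.d_homogeneous n))
      fun x hx => ?_
    have h_mem : π x ∈ (gradedMaximalIdeal 𝒜 • (⊤ : Submodule A (F.ι n →₀ A))).map π := by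
      obtain ⟨y, rfl⟩ := hx
      exact Submodule.mem_map_of_mem (hF n y)
    rw [hπ_id x hx, Submodule.map_smul'', Submodule.map_top] at h_mem
    exact Submodule.smul_mono le_rfl hπ_range h_mem
  refine ⟨fun e => one_notMem_gradedMaximalIdeal 𝒜 ?_⟩
  obtain ⟨y, hy⟩ : Finsupp.single e 1 ∈ LinearMap.range (F.d (n + 1)) := by
    refine (F.exact_succ n _).1 ?_
    rw [LinearMap.range_eq_bot.1 h_bot, LinearMap.zero_apply]
  simpa [hy] using mem_smul_top_finsupp_iff.1 (hF (n + 1) y) e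

theorem IsMinimal.projectiveDimension_le_iff [Nontrivial A] (hF : F.IsMinimal) (n : ℕ) :
    projectiveDimension (ModuleCat.of A M) ≤ n ↔ ∀ i, Nonempty (F.ι i) → i ≤ n := by
  rw [CategoryTheory.projectiveDimension_le_iff, HasProjectiveDimensionLE]
  constructor
  · rintro h i ⟨e⟩
    by_contra! hi
    obtain ⟨i, rfl⟩ := Nat.exists_eq_succ_of_ne_zero (Nat.ne_zero_of_lt hi)
    have h_proj := (F.hasProjectiveDimensionLT_succ_iff i).1
      (hasProjectiveDimensionLT_of_ge _ (n + 1) _ hi)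
    exact (hF.isEmpty_of_projective_syzygy h_proj).false e
  · intro h
    have : IsEmpty (F.ι (n + 1)) := ⟨fun e => absurd (h _ ⟨e⟩) (by omega)⟩
    exact (F.hasProjectiveDimensionLT_succ_iff n).2 F.projective_syzygy_of_isEmpty

end ProjectiveDimension

end GradedFreeResolution

section BidegreePart

variable {k : Type u} [Field k] {A : Type v} [CommRing A] [Algebra k A]

/-- The ring `A` shifted to start in bidegree `p`, in bidegree `q`. The first component of a
bidegree is a homological degree, which multiplication by elements of `A` preserves. -/
def bidegreePart (𝒜 : ℕ → Submodule k A) (p q : ℕ × ℕ) : Submodule k A :=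
  if q.1 = p.1 then shiftedPart 𝒜 p.2 q.2 else ⊥

variable {𝒜 : ℕ → Submodule k A}

theorem mem_bidegreePart_iff {p q : ℕ × ℕ} {a : A} :
    a ∈ bidegreePart 𝒜 p q ↔ a = 0 ∨ ∃ n, q = p + (0, n) ∧ a ∈ 𝒜 n := by
  rw [bidegreePart]
  split_ifs with h
  · simp [mem_shiftedPart_iff, Prod.ext_iff, h]
  · simp [Prod.ext_iff, h]

theorem fst_eq_of_mem_bidegreePart {p q : ℕ × ℕ} {a : A} (ha : a ∈ bidegreePart 𝒜 p q)
    (h : a ≠ 0) : q.1 = p.1 := by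
  obtain ⟨n, rfl, -⟩ := (mem_bidegreePart_iff.1 ha).resolve_left h
  rfl

theorem mem_shiftedPart_of_mem_bidegreePart {p q : ℕ × ℕ} {a : A}
    (ha : a ∈ bidegreePart 𝒜 p q) : a ∈ shiftedPart 𝒜 p.2 q.2 := by
  obtain rfl | ⟨n, rfl, hn⟩ := mem_bidegreePart_iff.1 ha
  · exact zero_mem _
  · exact mem_shiftedPart_add hn

theorem mem_bidegreePart_of_mem_shiftedPart {i m j : ℕ} {a : A} (ha : a ∈ shiftedPart 𝒜 m j) :
    a ∈ bidegreePart 𝒜 (i, m) (i, j) := by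
  rwa [bidegreePart, if_pos rfl]

theorem mem_bidegreePart_add_right {p q : ℕ × ℕ} (r : ℕ × ℕ) {a : A}
    (ha : a ∈ bidegreePart 𝒜 p q) : a ∈ bidegreePart 𝒜 (p + r) (q + r) := by
  obtain rfl | ⟨n, rfl, hn⟩ := mem_bidegreePart_iff.1 ha
  · exact zero_mem _
  · exact mem_bidegreePart_iff.2 (.inr ⟨n, add_right_comm _ _ _, hn⟩)

theorem one_mem_bidegreePart [SetLike.GradedOne 𝒜] (p : ℕ × ℕ) : 1 ∈ bidegreePart 𝒜 p p :=
  mem_bidegreePart_iff.2 (.inr ⟨0, rfl, SetLike.GradedOne.one_mem⟩)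

theorem mul_mem_bidegreePart [SetLike.GradedMul 𝒜] {p q r : ℕ × ℕ} {a b : A}
    (ha : a ∈ bidegreePart 𝒜 q r) (hb : b ∈ bidegreePart 𝒜 p q) :
    a * b ∈ bidegreePart 𝒜 p r := by
  obtain rfl | ⟨m, rfl, hm⟩ := mem_bidegreePart_iff.1 ha
  · simp
  obtain rfl | ⟨n, rfl, hn⟩ := mem_bidegreePart_iff.1 hb
  · simp
  refine mem_bidegreePart_iff.2 (.inr ⟨m + n, ?_, SetLike.GradedMul.mul_mem hm hn⟩)
  simp [add_assoc, add_comm n]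

theorem single_one_mem_bidegreePart [SetLike.GradedOne 𝒜] {ι : Type*} (p : ι → ℕ × ℕ) (e f : ι) :
    Finsupp.single e (1 : A) f ∈ bidegreePart 𝒜 (p f) (p e) := by
  classical
  rw [Finsupp.single_apply]
  split_ifs with h
  · exact h ▸ one_mem_bidegreePart _
  · exact zero_mem _

theorem linearMap_apply_eq_sum {ι M : Type*} [AddCommGroup M] [Module A M]
    (f : (ι →₀ A) →ₗ[A] M) (x : ι →₀ A) :
    f x = ∑ e ∈ x.support, x e • f (Finsupp.single e 1) := by
  conv_lhs => rw [← x.sum_single, Finsupp.sum, map_sum]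
  simp [← map_smul]

theorem map_mem_bidegreePart [SetLike.GradedMul 𝒜] {ι κ : Type*} {p : κ → ℕ × ℕ}
    {q : ι → ℕ × ℕ} {r : ℕ × ℕ} {f : (ι →₀ A) →ₗ[A] (κ →₀ A)}
    (hf : ∀ e e', f (Finsupp.single e 1) e' ∈ bidegreePart 𝒜 (p e') (q e)) {x : ι →₀ A}
    (hx : ∀ e, x e ∈ bidegreePart 𝒜 (q e) r) (e' : κ) : f x e' ∈ bidegreePart 𝒜 (p e') r := by
  rw [linearMap_apply_eq_sum, Finsupp.finsetSum_apply]
  exact sum_mem fun e _ => mul_mem_bidegreePart (hx e) (hf e e')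

end BidegreePart

section Pieces

variable {A : Type v} [CommRing A] {ι : Type*} {P : ℕ → Type*} (σ : (Σ i, P i) ≃ ι)

/-- The inclusion of the `i`-th piece of a free module whose basis is partitioned by `σ`. -/
noncomputable def pieceIncl (i : ℕ) : (P i →₀ A) →ₗ[A] (ι →₀ A) :=
  Finsupp.lmapDomain A A fun p => σ ⟨i, p⟩

/-- The projection to the `i`-th piece of a free module whose basis is partitioned by `σ`. -/
noncomputable def pieceProj (i : ℕ) : (ι →₀ A) →ₗ[A] (P i →₀ A) :=
  Finsupp.lcomapDomain (fun p => σ ⟨i, p⟩) (σ.injective.comp sigma_mk_injective)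

/-- The linear map on a free module whose basis is partitioned by `σ` with given restrictions to the
pieces. The restrictions may be linear over a smaller ring `B`. -/
noncomputable def pieceLift (B : Type*) [Semiring B] [Module B A] {N : Type*} [AddCommGroup N]
    [Module B N] (f : ∀ i, (P i →₀ A) →ₗ[B] N) : (ι →₀ A) →ₗ[B] N :=
  Finsupp.lsum ℕ fun e => f (σ.symm e).1 ∘ₗ Finsupp.lsingle (σ.symm e).2

@[simp]
theorem pieceIncl_single (i : ℕ) (p : P i) (a : A) :
    pieceIncl σ i (Finsupp.single p a) = Finsupp.single (σ ⟨i, p⟩) a :=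
  Finsupp.mapDomain_single

theorem pieceIncl_apply (i : ℕ) (x : P i →₀ A) (p : P i) : pieceIncl σ i x (σ ⟨i, p⟩) = x p :=
  Finsupp.mapDomain_apply (σ.injective.comp sigma_mk_injective) _ _

theorem pieceIncl_apply_of_ne {i j : ℕ} (h : j ≠ i) (x : P i →₀ A) (p : P j) :
    pieceIncl σ i x (σ ⟨j, p⟩) = 0 :=
  Finsupp.mapDomain_of_notMem_range _ _
    fun ⟨_, hp⟩ => h (congrArg Sigma.fst (σ.injective hp)).symm

@[simp]
theorem pieceProj_apply (i : ℕ) (x : ι →₀ A) (p : P i) : pieceProj σ i x p = x (σ ⟨i, p⟩) := rfl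

@[simp]
theorem pieceProj_pieceIncl (i : ℕ) (x : P i →₀ A) : pieceProj σ i (pieceIncl σ i x) = x :=
  Finsupp.ext (pieceIncl_apply σ i x)

theorem pieceProj_pieceIncl_of_ne {i j : ℕ} (h : j ≠ i) (x : P i →₀ A) :
    pieceProj σ j (pieceIncl σ i x) = 0 :=
  Finsupp.ext (pieceIncl_apply_of_ne σ h x)

theorem pieceIncl_eq_zero_iff {i : ℕ} {x : P i →₀ A} : pieceIncl σ i x = 0 ↔ x = 0 :=
  (Function.LeftInverse.injective (pieceProj_pieceIncl σ i)).eq_iff' (map_zero _)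

variable {σ} in
theorem eq_of_forall_pieceIncl {F N : Type*} [AddCommGroup N] [FunLike F (ι →₀ A) N]
    [AddMonoidHomClass F (ι →₀ A) N] {f g : F}
    (h : ∀ i x, f (pieceIncl σ i x) = g (pieceIncl σ i x)) : f = g := by
  refine DFunLike.ext _ _ fun x => ?_
  induction x using Finsupp.induction_linear with
  | zero => simp only [map_zero]
  | add x y hx hy => simp only [map_add, hx, hy]
  | single e a => simpa using h (σ.symm e).1 (Finsupp.single (σ.symm e).2 a)

@[simp]
theorem pieceLift_pieceIncl (B : Type*) [Semiring B] [Module B A] {N : Type*} [AddCommGroup N]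
    [Module B N] (f : ∀ i, (P i →₀ A) →ₗ[B] N) (i : ℕ) (x : P i →₀ A) :
    pieceLift σ B f (pieceIncl σ i x) = f i x := by
  induction x using Finsupp.induction_linear with
  | zero => simp only [map_zero]
  | add x y hx hy => simp only [map_add, hx, hy]
  | single p a =>
    rw [pieceIncl_single, pieceLift, Finsupp.lsum_single, σ.symm_apply_apply]
    rfl

theorem mem_of_forall_pieceIncl_pieceProj_mem {N : Submodule A (ι →₀ A)} {x : ι →₀ A}
    (h : ∀ i, pieceIncl σ i (pieceProj σ i x) ∈ N) : x ∈ N := by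
  classical
  have hx : x = ∑ i ∈ x.support.image fun e => (σ.symm e).1,
      pieceIncl σ i (pieceProj σ i x) := by
    ext e
    obtain ⟨⟨i, p⟩, rfl⟩ := σ.surjective e
    rw [Finsupp.finsetSum_apply, Finset.sum_eq_single i, pieceIncl_apply, pieceProj_apply]
    · exact fun j _ hj => pieceIncl_apply_of_ne σ hj.symm _ p
    · intro hi
      rw [pieceIncl_apply, pieceProj_apply]
      by_contra hne
      exact hi (Finset.mem_image.2 ⟨_, Finsupp.mem_support_iff.2 hne, by simp⟩)
  rw [hx]
  exact sum_mem fun i _ => h i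

theorem pieceIncl_pieceProj_of_support {i : ℕ} {x : ι →₀ A}
    (h : ∀ e, x e ≠ 0 → (σ.symm e).1 = i) : pieceIncl σ i (pieceProj σ i x) = x := by
  ext e
  obtain ⟨⟨j, p⟩, rfl⟩ := σ.surjective e
  obtain rfl | hj := eq_or_ne j i
  · exact pieceIncl_apply σ _ _ _
  · rw [pieceIncl_apply_of_ne σ hj]
    by_contra hne
    exact hj (by simpa using h _ (Ne.symm hne))

/-- The endomorphism which is `(-1) ^ i` on the `i`-th piece. -/
noncomputable def pieceSign : (ι →₀ A) →ₗ[A] (ι →₀ A) :=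
  pieceLift σ A fun i => (-1 : A) ^ i • pieceIncl σ i

theorem pieceSign_pieceIncl (i : ℕ) (x : P i →₀ A) :
    pieceSign σ (pieceIncl σ i x) = (-1 : A) ^ i • pieceIncl σ i x :=
  pieceLift_pieceIncl σ A _ i x

theorem pieceSign_single (e : ι) (a : A) :
    pieceSign σ (Finsupp.single e a) = (-1 : A) ^ (σ.symm e).1 • Finsupp.single e a := by
  simp [pieceSign, pieceLift]

theorem pieceSign_apply (x : ι →₀ A) (e : ι) :
    pieceSign σ x e = (-1 : A) ^ (σ.symm e).1 * x e := by
  classical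
  suffices Finsupp.lapply e ∘ₗ pieceSign σ =
      (-1 : A) ^ (σ.symm e).1 • (Finsupp.lapply e : (ι →₀ A) →ₗ[A] A) from
    LinearMap.congr_fun this x
  ext f
  obtain rfl | h := eq_or_ne f e
  · simp [pieceSign_single]
  · simp [pieceSign_single, Finsupp.single_eq_of_ne h.symm]

/-- The endomorphism `d` and the map `aug` are assembled from the differentials and the augmentation
of a complex of free modules `⋯ → P_1 → P_0 → A`. -/
structure IsTotalComplex (δ : ∀ i, (P (i + 1) →₀ A) →ₗ[A] (P i →₀ A)) (ε : (P 0 →₀ A) →ₗ[A] A)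
    (d : (ι →₀ A) →ₗ[A] (ι →₀ A)) (aug : (ι →₀ A) →ₗ[A] A) : Prop where
  d_zero : ∀ x, d (pieceIncl σ 0 x) = 0
  d_succ : ∀ i x, d (pieceIncl σ (i + 1) x) = pieceIncl σ i (δ i x)
  aug_zero : ∀ x, aug (pieceIncl σ 0 x) = ε x
  aug_succ : ∀ i x, aug (pieceIncl σ (i + 1) x) = 0

namespace IsTotalComplex

variable {σ} {δ : ∀ i, (P (i + 1) →₀ A) →ₗ[A] (P i →₀ A)} {ε : (P 0 →₀ A) →ₗ[A] A}
  {d : (ι →₀ A) →ₗ[A] (ι →₀ A)} {aug : (ι →₀ A) →ₗ[A] A} (h : IsTotalComplex σ δ ε d aug)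
include h

theorem pieceProj_d (i : ℕ) (x : ι →₀ A) :
    pieceProj σ i (d x) = δ i (pieceProj σ (i + 1) x) := by
  suffices pieceProj σ i ∘ₗ d = δ i ∘ₗ pieceProj σ (i + 1) from LinearMap.congr_fun this x
  refine eq_of_forall_pieceIncl (σ := σ) fun j y => ?_
  cases j with
  | zero => simp [h.d_zero, pieceProj_pieceIncl_of_ne]
  | succ j =>
    obtain rfl | hj := eq_or_ne i j
    · simp [h.d_succ]
    · simp [h.d_succ, pieceProj_pieceIncl_of_ne, hj]

theorem aug_pieceProj (x : ι →₀ A) : ε (pieceProj σ 0 x) = aug x := by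
  suffices ε ∘ₗ pieceProj σ 0 = aug from LinearMap.congr_fun this x
  refine eq_of_forall_pieceIncl (σ := σ) fun j y => ?_
  cases j with
  | zero => simp [h.aug_zero]
  | succ j => simp [h.aug_succ, pieceProj_pieceIncl_of_ne]

theorem mem_range_d_iff {x : ι →₀ A} :
    x ∈ LinearMap.range d ↔ ∀ i, pieceProj σ i x ∈ LinearMap.range (δ i) := by
  constructor
  · rintro ⟨y, rfl⟩ i
    exact ⟨_, (h.pieceProj_d i y).symm⟩
  · intro hx
    refine mem_of_forall_pieceIncl_pieceProj_mem σ fun i => ?_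
    obtain ⟨y, hy⟩ := hx i
    exact ⟨pieceIncl σ (i + 1) y, by rw [h.d_succ, hy]⟩

theorem mem_ker_d_inf_ker_aug_iff {x : ι →₀ A} :
    x ∈ LinearMap.ker d ⊓ LinearMap.ker aug ↔
      ε (pieceProj σ 0 x) = 0 ∧ ∀ i, δ i (pieceProj σ (i + 1) x) = 0 := by
  simp only [Submodule.mem_inf, LinearMap.mem_ker, h.aug_pieceProj, ← h.pieceProj_d]
  refine and_comm.trans (and_congr_right fun _ => ⟨fun hx i => by rw [hx, map_zero], fun hx => ?_⟩)
  refine mem_of_forall_pieceIncl_pieceProj_mem (N := ⊥) σ fun i => ?_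
  rw [hx, map_zero]
  exact zero_mem _

theorem pieceIncl_mem_range_d_iff {i : ℕ} {x : P i →₀ A} :
    pieceIncl σ i x ∈ LinearMap.range d ↔ x ∈ LinearMap.range (δ i) := by
  refine ⟨fun ⟨y, hy⟩ => ⟨_, (h.pieceProj_d i y).symm.trans ?_⟩,
    fun ⟨y, hy⟩ => ⟨_, hy ▸ h.d_succ i y⟩⟩
  rw [hy, pieceProj_pieceIncl]

theorem range_d_eq_iff :
    LinearMap.range d = LinearMap.ker d ⊓ LinearMap.ker aug ↔
      Function.Exact (δ 0) ε ∧ ∀ i, Function.Exact (δ (i + 1)) (δ i) := by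
  refine ⟨fun heq => ⟨fun x => ?_, fun i x => ?_⟩, fun ⟨h_zero, h_succ⟩ => ?_⟩
  · refine Iff.trans ?_ h.pieceIncl_mem_range_d_iff
    simp [heq, h.d_zero, h.aug_zero]
  · refine Iff.trans ?_ h.pieceIncl_mem_range_d_iff
    simp [heq, h.d_succ, h.aug_succ, pieceIncl_eq_zero_iff]
  · ext x
    rw [h.mem_range_d_iff, h.mem_ker_d_inf_ker_aug_iff]
    exact ⟨fun hx => ⟨(h_zero _).2 (hx 0), fun i => (h_succ i _).2 (hx (i + 1))⟩,
      fun hx i => i.casesOn ((h_zero _).1 hx.1) fun i => (h_succ i _).1 (hx.2 i)⟩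

theorem range_aug_eq : LinearMap.range aug = LinearMap.range ε := by
  ext a
  exact ⟨fun ⟨x, hx⟩ => ⟨_, (h.aug_pieceProj x).trans hx⟩,
    fun ⟨x, hx⟩ => ⟨_, (h.aug_zero x).trans hx⟩⟩

theorem pieceSign_d (x : ι →₀ A) : pieceSign σ (d x) = -d (pieceSign σ x) := by
  suffices pieceSign σ ∘ₗ d = -(d ∘ₗ pieceSign σ) from LinearMap.congr_fun this x
  refine eq_of_forall_pieceIncl (σ := σ) fun i y => ?_
  cases i with
  | zero => simp [pieceSign_pieceIncl, h.d_zero]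
  | succ i => simp [pieceSign_pieceIncl, h.d_succ, pow_succ]

theorem aug_pieceSign (x : ι →₀ A) : aug (pieceSign σ x) = aug x := by
  suffices aug ∘ₗ pieceSign σ = aug from LinearMap.congr_fun this x
  refine eq_of_forall_pieceIncl (σ := σ) fun i y => ?_
  cases i with
  | zero => simp [pieceSign_pieceIncl]
  | succ i => simp [pieceSign_pieceIncl, h.aug_succ]

end IsTotalComplex

/-- The endomorphism assembled from the differentials of a complex of free modules. -/
noncomputable def totalDifferential (δ : ∀ i, (P (i + 1) →₀ A) →ₗ[A] (P i →₀ A)) :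
    (ι →₀ A) →ₗ[A] (ι →₀ A) :=
  pieceLift σ A fun
    | 0 => 0
    | i + 1 => pieceIncl σ i ∘ₗ δ i

/-- The map which is the given augmentation on the piece of index `0` and vanishes on the others. -/
noncomputable def totalAugmentation (ε : (P 0 →₀ A) →ₗ[A] A) : (ι →₀ A) →ₗ[A] A :=
  pieceLift σ A fun
    | 0 => ε
    | _ + 1 => 0

theorem isTotalComplex_total (δ : ∀ i, (P (i + 1) →₀ A) →ₗ[A] (P i →₀ A))
    (ε : (P 0 →₀ A) →ₗ[A] A) :
    IsTotalComplex σ δ ε (totalDifferential σ δ) (totalAugmentation σ ε) where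
  d_zero := pieceLift_pieceIncl σ A _ 0
  d_succ i := pieceLift_pieceIncl σ A _ (i + 1)
  aug_zero := pieceLift_pieceIncl σ A _ 0
  aug_succ i := pieceLift_pieceIncl σ A _ (i + 1)

end Pieces

section Contraction

theorem exists_generalizedInverse {k : Type*} [Field k] {V W : Type*} [AddCommGroup V] [Module k V]
    [AddCommGroup W] [Module k W] (f : V →ₗ[k] W) : ∃ g : W →ₗ[k] V, f ∘ₗ g ∘ₗ f = f := by
  obtain ⟨s, hs⟩ := f.rangeRestrict.exists_rightInverse_of_surjective f.range_rangeRestrict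
  obtain ⟨p, hp⟩ := (LinearMap.range f).subtype.exists_leftInverse_of_injective
    (LinearMap.range f).ker_subtype
  refine ⟨s ∘ₗ p, LinearMap.ext fun x => ?_⟩
  have hp_apply : p (f x) = f.rangeRestrict x := LinearMap.congr_fun hp (f.rangeRestrict x)
  rw [LinearMap.comp_apply, LinearMap.comp_apply, LinearMap.comp_apply, hp_apply]
  exact congrArg Subtype.val (LinearMap.congr_fun hs (f.rangeRestrict x))

/-- The maps `d` and `aug` are an augmented complex with sign involution `τ`, which the maps `h` and
`η`, of odd and of even degree, contract onto its augmentation. -/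
structure IsContraction {k V W : Type*} [CommRing k] [AddCommGroup V] [Module k V] [AddCommGroup W]
    [Module k W] (d τ : V →ₗ[k] V) (aug : V →ₗ[k] W) (h : V →ₗ[k] V) (η : W →ₗ[k] V) : Prop where
  d_d : ∀ x, d (d x) = 0
  aug_d : ∀ x, aug (d x) = 0
  sign_d : ∀ x, τ (d x) = -d (τ x)
  aug_sign : ∀ x, aug (τ x) = aug x
  homotopy : ∀ x, d (h x) + h (d x) = x - η (aug x)
  sign_h : ∀ x, τ (h x) = -h (τ x)
  d_η : ∀ a, d (η a) = 0
  sign_η : ∀ a, τ (η a) = η a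

variable {k : Type u} [Field k] {A : Type v} [CommRing A] [Algebra k A] {ι : Type*}
  {P : ℕ → Type*} {σ : (Σ i, P i) ≃ ι} {δ : ∀ i, (P (i + 1) →₀ A) →ₗ[A] (P i →₀ A)}
  {ε : (P 0 →₀ A) →ₗ[A] A} {d : (ι →₀ A) →ₗ[A] (ι →₀ A)} {aug : (ι →₀ A) →ₗ[A] A}

namespace IsTotalComplex

variable (k) in
theorem exists_generalizedInverse_d (h : IsTotalComplex σ δ ε d aug) :
    ∃ g : (ι →₀ A) →ₗ[k] (ι →₀ A), (∀ x, d (g (d x)) = d x) ∧ (∀ x, aug (g x) = 0) ∧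
      ∀ x, pieceSign σ (g x) = -g (pieceSign σ x) := by
  choose g hg using fun i => exists_generalizedInverse ((δ i).restrictScalars k)
  have hg_apply (i x) : δ i (g i (δ i x)) = δ i x := LinearMap.congr_fun (hg i) x
  let G : (ι →₀ A) →ₗ[k] (ι →₀ A) :=
    pieceLift σ k fun i => (pieceIncl σ (i + 1)).restrictScalars k ∘ₗ g i
  have hG (i x) : G (pieceIncl σ i x) = pieceIncl σ (i + 1) (g i x) := by
    simp [G]
  refine ⟨G, fun x => ?_, fun x => ?_, fun x => ?_⟩
  · suffices d.restrictScalars k ∘ₗ G ∘ₗ d.restrictScalars k = d.restrictScalars k from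
      LinearMap.congr_fun this x
    refine eq_of_forall_pieceIncl (σ := σ) fun i y => ?_
    cases i with
    | zero => simp [h.d_zero]
    | succ i => simp [h.d_succ, hG, hg_apply]
  · suffices aug.restrictScalars k ∘ₗ G = 0 from LinearMap.congr_fun this x
    refine eq_of_forall_pieceIncl (σ := σ) fun i y => ?_
    simp [hG, h.aug_succ]
  · suffices (pieceSign σ).restrictScalars k ∘ₗ G = -(G ∘ₗ (pieceSign σ).restrictScalars k) from
      LinearMap.congr_fun this x
    refine eq_of_forall_pieceIncl (σ := σ) fun i y => ?_
    obtain hi | hi := neg_one_pow_eq_or A i <;> simp [hG, pieceSign_pieceIncl, pow_succ, hi]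

variable (k) in
theorem exists_generalizedInverse_aug (h : IsTotalComplex σ δ ε d aug) :
    ∃ η : A →ₗ[k] (ι →₀ A), (∀ x, aug (η (aug x)) = aug x) ∧ (∀ a, d (η a) = 0) ∧
      ∀ a, pieceSign σ (η a) = η a := by
  obtain ⟨η, hη⟩ := exists_generalizedInverse (ε.restrictScalars k)
  refine ⟨(pieceIncl σ 0).restrictScalars k ∘ₗ η, fun x => ?_, fun a => h.d_zero _, fun a => ?_⟩
  · rw [← h.aug_pieceProj x]
    exact (h.aug_zero _).trans (LinearMap.congr_fun hη (pieceProj σ 0 x))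
  · simp [pieceSign_pieceIncl]

variable (k) in
theorem exists_isContraction (h : IsTotalComplex σ δ ε d aug)
    (h_range : LinearMap.range d = LinearMap.ker d ⊓ LinearMap.ker aug) :
    ∃ H η, IsContraction (d.restrictScalars k) ((pieceSign σ).restrictScalars k)
      (aug.restrictScalars k) H η := by
  obtain ⟨g, h_dgd, h_aug_g, h_sign_g⟩ := h.exists_generalizedInverse_d k
  obtain ⟨η, h_aug_η, h_d_η, h_sign_η⟩ := h.exists_generalizedInverse_aug k
  have h_d_d (x) : d (d x) = 0 := (h_range.le ⟨x, rfl⟩).1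
  have h_aug_d (x) : aug (d x) = 0 := (h_range.le ⟨x, rfl⟩).2
  refine ⟨g ∘ₗ (LinearMap.id - η ∘ₗ aug.restrictScalars k - g ∘ₗ d.restrictScalars k), η,
    h_d_d, h_aug_d, h.pieceSign_d, h.aug_pieceSign, fun x => ?_, fun x => ?_, h_d_η, h_sign_η⟩
  · obtain ⟨y, hy⟩ : x - η (aug x) - g (d x) ∈ LinearMap.range d := by
      rw [h_range]
      exact ⟨by simp [h_d_η, h_dgd], by simp [h_aug_η, h_aug_g]⟩
    have h_dg : d (g (x - η (aug x) - g (d x))) = x - η (aug x) - g (d x) := by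
      rw [← hy, h_dgd]
    simpa [h_d_d, h_aug_d] using eq_sub_iff_add_eq.1 h_dg
  · simp only [LinearMap.comp_apply, LinearMap.sub_apply, LinearMap.id_apply,
      LinearMap.coe_restrictScalars, map_sub, map_neg, h_sign_g, h_sign_η, h.aug_pieceSign,
      h.pieceSign_d]
    abel

end IsTotalComplex

end Contraction

section MinimalResolution

variable {k : Type u} [Field k] {A : Type v} [CommRing A] [Algebra k A]

theorem pieceIncl_apply_mem {ι : Type*} {P : ℕ → Type*} (σ : (Σ i, P i) ≃ ι) {N : Type*}
    [SetLike N A] [ZeroMemClass N A] {B : ι → N} {i : ℕ} {x : P i →₀ A}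
    (hx : ∀ p, x p ∈ B (σ ⟨i, p⟩)) (e : ι) : pieceIncl σ i x e ∈ B e := by
  obtain ⟨⟨j, p⟩, rfl⟩ := σ.surjective e
  obtain rfl | hj := eq_or_ne j i
  · rw [pieceIncl_apply]
    exact hx p
  · rw [pieceIncl_apply_of_ne σ hj]
    exact zero_mem _

theorem totalDifferential_single_apply_mem {ι : Type*} {P : ℕ → Type*} (σ : (Σ i, P i) ≃ ι)
    {δ : ∀ i, (P (i + 1) →₀ A) →ₗ[A] (P i →₀ A)} {N : Type*} [SetLike N A] [ZeroMemClass N A]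
    {B : ι → ι → N} (hδ : ∀ i p q, δ i (Finsupp.single p 1) q ∈ B (σ ⟨i + 1, p⟩) (σ ⟨i, q⟩))
    (e f : ι) : totalDifferential σ δ (Finsupp.single e 1) f ∈ B e f := by
  obtain ⟨⟨i, p⟩, rfl⟩ := σ.surjective e
  have h := isTotalComplex_total σ δ 0
  rw [← pieceIncl_single]
  cases i with
  | zero =>
    rw [h.d_zero]
    exact zero_mem _
  | succ i =>
    rw [h.d_succ]
    exact pieceIncl_apply_mem σ (hδ i p) f

/-- A minimal graded free resolution of the ideal `K`, written as a single free module with a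
differential. The bidegree of a basis element consists of its homological degree and its internal
degree, and the augmentation is extended by zero to positive homological degrees. -/
structure MinimalResolution (𝒜 : ℕ → Submodule k A) (K : Ideal A) where
  ι : Type v
  bideg : ι → ℕ × ℕ
  d : (ι →₀ A) →ₗ[A] (ι →₀ A)
  aug : (ι →₀ A) →ₗ[A] A
  d_mem : ∀ e f, d (Finsupp.single e 1) f ∈ bidegreePart 𝒜 (bideg f + (1, 0)) (bideg e)
  d_minimal : ∀ e f, d (Finsupp.single e 1) f ∈ gradedMaximalIdeal 𝒜
  aug_mem : ∀ e, aug (Finsupp.single e 1) ∈ bidegreePart 𝒜 0 (bideg e)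
  range_d : LinearMap.range d = LinearMap.ker d ⊓ LinearMap.ker aug
  range_aug : LinearMap.range aug = K

variable {𝒜 : ℕ → Submodule k A}

theorem mem_of_mem_bidegreePart_zero {q : ℕ × ℕ} {a : A} (ha : a ∈ bidegreePart 𝒜 0 q) :
    a ∈ 𝒜 q.2 := by
  obtain rfl | ⟨n, rfl, hn⟩ := mem_bidegreePart_iff.1 ha
  · exact zero_mem _
  · simpa using hn

namespace MinimalResolution

variable {K L : Ideal A} (X : MinimalResolution 𝒜 K) {Y : MinimalResolution 𝒜 L}

/-- The set of bidegrees of the basis elements. -/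
def shape : Set (ℕ × ℕ) := Set.range X.bideg

@[simp]
theorem d_d (x : X.ι →₀ A) : X.d (X.d x) = 0 := (X.range_d.le ⟨x, rfl⟩).1

@[simp]
theorem aug_d (x : X.ι →₀ A) : X.aug (X.d x) = 0 := (X.range_d.le ⟨x, rfl⟩).2

theorem isHomogeneous [GradedAlgebra 𝒜] (X : MinimalResolution 𝒜 K) : K.IsHomogeneous 𝒜 :=
  X.range_aug ▸ range_isHomogeneous 𝒜 fun e => mem_of_mem_bidegreePart_zero (X.aug_mem e)

/-- The basis elements of homological degree `i`. -/
abbrev Basis (i : ℕ) : Type v := {e : X.ι // (X.bideg e).1 = i}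

/-- The partition of the basis by homological degree. -/
abbrev partition : (Σ i, X.Basis i) ≃ X.ι := Equiv.sigmaFiberEquiv fun e => (X.bideg e).1

/-- The differential in a fixed homological degree. -/
noncomputable def gradedD (i : ℕ) : (X.Basis (i + 1) →₀ A) →ₗ[A] (X.Basis i →₀ A) :=
  pieceProj X.partition i ∘ₗ X.d ∘ₗ pieceIncl X.partition (i + 1)

theorem fst_bideg_eq {i : ℕ} (p : X.Basis i) {f : X.ι}
    (h : X.d (pieceIncl X.partition i (Finsupp.single p 1)) f ≠ 0) : i = (X.bideg f).1 + 1 := by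
  rw [pieceIncl_single] at h
  exact p.2.symm.trans (fst_eq_of_mem_bidegreePart (X.d_mem p.1 f) h)

theorem isTotalComplex :
    IsTotalComplex X.partition X.gradedD (X.aug ∘ₗ pieceIncl X.partition 0) X.d X.aug where
  d_zero x := by
    suffices X.d ∘ₗ pieceIncl X.partition 0 = 0 from LinearMap.congr_fun this x
    ext p f
    by_contra h
    exact absurd (X.fst_bideg_eq p h) (Nat.succ_ne_zero _).symm
  d_succ i x := by
    suffices X.d ∘ₗ pieceIncl X.partition (i + 1) = pieceIncl X.partition i ∘ₗ X.gradedD i from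
      LinearMap.congr_fun this x
    ext1 p
    ext1
    exact (pieceIncl_pieceProj_of_support X.partition fun f hf =>
      (Nat.succ.inj (X.fst_bideg_eq p hf)).symm).symm
  aug_zero _ := rfl
  aug_succ i x := by
    suffices X.aug ∘ₗ pieceIncl X.partition (i + 1) = 0 from LinearMap.congr_fun this x
    ext p
    by_contra h
    rw [LinearMap.comp_apply, LinearMap.comp_apply, Finsupp.lsingle_apply, pieceIncl_single] at h
    exact absurd (p.2.symm.trans (fst_eq_of_mem_bidegreePart (X.aug_mem p.1) h))
      (Nat.succ_ne_zero i)

theorem exists_cycle {a : A} (ha : a ∈ K) : ∃ z, X.d z = 0 ∧ X.aug z = a := by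
  rw [← X.range_aug, X.isTotalComplex.range_aug_eq] at ha
  obtain ⟨z, hz⟩ := ha
  exact ⟨_, X.isTotalComplex.d_zero z, hz⟩

/-- The resolution as a sequence of maps of graded free modules. -/
noncomputable def toGraded : GradedFreeResolution 𝒜 (idealGrading 𝒜 K) where
  ι := X.Basis
  deg _ e := (X.bideg e.1).2
  d := X.gradedD
  aug := (X.aug ∘ₗ pieceIncl X.partition 0).codRestrict K fun _ => X.range_aug.le ⟨_, rfl⟩
  d_homogeneous i e := by
    refine mem_freeGrading_iff.2 fun f => ?_
    rw [gradedD, LinearMap.comp_apply, LinearMap.comp_apply, pieceIncl_single, pieceProj_apply]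
    simpa using mem_shiftedPart_of_mem_bidegreePart (X.d_mem e.1 f.1)
  aug_homogeneous e := by
    change X.aug (pieceIncl X.partition 0 (Finsupp.single e 1)) ∈ 𝒜 _
    rw [pieceIncl_single]
    exact mem_of_mem_bidegreePart_zero (X.aug_mem e.1)
  exact_succ := (X.isTotalComplex.range_d_eq_iff.1 X.range_d).2
  exact_zero x := Subtype.ext_iff.trans ((X.isTotalComplex.range_d_eq_iff.1 X.range_d).1 x)
  aug_surjective := fun ⟨a, ha⟩ => by
    rw [← X.range_aug, X.isTotalComplex.range_aug_eq] at ha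
    exact ha.imp fun _ hx => Subtype.ext hx

theorem toGraded_isMinimal : X.toGraded.IsMinimal := fun i x => by
  refine mem_smul_top_finsupp_iff.2 fun e => ?_
  change X.d _ e.1 ∈ _
  rw [linearMap_apply_eq_sum, Finsupp.finsetSum_apply]
  exact sum_mem fun f _ => Ideal.mul_mem_left _ _ (X.d_minimal f e.1)

/-- Maps of resolutions which preserve the bidegrees and lift an inclusion of ideals. -/
structure IsHom (X : MinimalResolution 𝒜 K) (Y : MinimalResolution 𝒜 L)
    (φ : (X.ι →₀ A) →ₗ[A] (Y.ι →₀ A)) : Prop where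
  mem : ∀ e f, φ (Finsupp.single e 1) f ∈ bidegreePart 𝒜 (Y.bideg f) (X.bideg e)
  comm : ∀ x, Y.d (φ x) = φ (X.d x)
  aug : ∀ x, Y.aug (φ x) = X.aug x

namespace IsHom

theorem id [SetLike.GradedOne 𝒜] (X : MinimalResolution 𝒜 K) : X.IsHom X LinearMap.id where
  mem := single_one_mem_bidegreePart X.bideg
  comm _ := rfl
  aug _ := rfl

theorem comp [SetLike.GradedMul 𝒜] {M : Ideal A} {X : MinimalResolution 𝒜 K}
    {Z : MinimalResolution 𝒜 M} {φ : (X.ι →₀ A) →ₗ[A] (Y.ι →₀ A)}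
    {ψ : (Y.ι →₀ A) →ₗ[A] (Z.ι →₀ A)} (hψ : Y.IsHom Z ψ) (hφ : X.IsHom Y φ) :
    X.IsHom Z (ψ ∘ₗ φ) where
  mem e := map_mem_bidegreePart hψ.mem (hφ.mem e)
  comm x := by simp [hψ.comm, hφ.comm]
  aug x := by simp [hψ.aug, hφ.aug]

end IsHom

/-- The map of resolutions assembled from its components in the homological degrees. -/
noncomputable def totalMap (X : MinimalResolution 𝒜 K) (Y : MinimalResolution 𝒜 L)
    (φ : ∀ i, (X.Basis i →₀ A) →ₗ[A] (Y.Basis i →₀ A)) : (X.ι →₀ A) →ₗ[A] (Y.ι →₀ A) :=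
  pieceLift X.partition A fun i => pieceIncl Y.partition i ∘ₗ φ i

theorem totalMap_pieceIncl (φ : ∀ i, (X.Basis i →₀ A) →ₗ[A] (Y.Basis i →₀ A)) (i : ℕ)
    (x : X.Basis i →₀ A) :
    X.totalMap Y φ (pieceIncl X.partition i x) = pieceIncl Y.partition i (φ i x) :=
  pieceLift_pieceIncl X.partition A _ i x

theorem totalMap_single (φ : ∀ i, (X.Basis i →₀ A) →ₗ[A] (Y.Basis i →₀ A)) (e : X.ι) :
    X.totalMap Y φ (Finsupp.single e 1) =
      pieceIncl Y.partition _ (φ (X.bideg e).1 (Finsupp.single ⟨e, rfl⟩ 1)) := by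
  rw [← totalMap_pieceIncl, pieceIncl_single]
  rfl

variable {X} in
theorem isHom_totalMap {h : K ≤ L} {φ : ∀ i, (X.Basis i →₀ A) →ₗ[A] (Y.Basis i →₀ A)}
    (hφ : X.toGraded.IsLift Y.toGraded (Submodule.inclusion h) φ) :
    X.IsHom Y (X.totalMap Y φ) where
  mem e := by
    rw [totalMap_single]
    refine pieceIncl_apply_mem Y.partition (B := fun f => bidegreePart 𝒜 (Y.bideg f) (X.bideg e))
      fun p => ?_
    have hp := mem_bidegreePart_of_mem_shiftedPart (i := (X.bideg e).1)
      (mem_freeGrading_iff.1 (hφ.graded (X.bideg e).1 ⟨e, rfl⟩) p)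
    rwa [show ((X.bideg e).1, Y.toGraded.deg _ p) = Y.bideg p.1 from Prod.ext p.2.symm rfl] at hp
  comm x := by
    suffices Y.d ∘ₗ X.totalMap Y φ = X.totalMap Y φ ∘ₗ X.d from LinearMap.congr_fun this x
    refine eq_of_forall_pieceIncl (σ := X.partition) fun i y => ?_
    simp only [LinearMap.comp_apply, totalMap_pieceIncl]
    cases i with
    | zero => rw [X.isTotalComplex.d_zero, Y.isTotalComplex.d_zero, map_zero]
    | succ i =>
      rw [X.isTotalComplex.d_succ, Y.isTotalComplex.d_succ, totalMap_pieceIncl]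
      exact congrArg _ (hφ.comm i y)
  aug x := by
    suffices Y.aug ∘ₗ X.totalMap Y φ = X.aug from LinearMap.congr_fun this x
    refine eq_of_forall_pieceIncl (σ := X.partition) fun i y => ?_
    rw [LinearMap.comp_apply, totalMap_pieceIncl]
    cases i with
    | zero => exact congrArg Subtype.val (hφ.aug y)
    | succ i => rw [X.isTotalComplex.aug_succ, Y.isTotalComplex.aug_succ]

theorem exists_isHom_of_tor_map_eq_zero [GradedAlgebra 𝒜] (X : MinimalResolution 𝒜 K)
    (Y : MinimalResolution 𝒜 L) (h : K ≤ L)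
    (h_tor : ∀ i, ((Tor (ModuleCat.{v} A) i).obj (ModuleCat.of A (A ⧸ gradedMaximalIdeal 𝒜))).map
      (ModuleCat.ofHom (Submodule.inclusion h)) = 0) :
    ∃ φ, X.IsHom Y φ ∧ ∀ e f, φ (Finsupp.single e 1) f ∈ gradedMaximalIdeal 𝒜 := by
  let _ := idealGradingDecomposition Y.isHomogeneous
  obtain ⟨φ, hφ⟩ : ∃ φ : ∀ i, (X.Basis i →₀ A) →ₗ[A] (Y.Basis i →₀ A),
      X.toGraded.IsLift Y.toGraded (Submodule.inclusion h) φ :=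
    X.toGraded.exists_isLift Y.toGraded fun _ _ hx => hx
  refine ⟨X.totalMap Y φ, isHom_totalMap hφ, fun e => ?_⟩
  rw [totalMap_single]
  exact pieceIncl_apply_mem Y.partition (B := fun _ => gradedMaximalIdeal 𝒜)
    (mem_smul_top_finsupp_iff.1 (hφ.mem_smul_top_of_tor_map_eq_zero X.toGraded_isMinimal
      Y.toGraded_isMinimal (h_tor _) _))

theorem exists_isContraction :
    ∃ H η, IsContraction (X.d.restrictScalars k) ((pieceSign X.partition).restrictScalars k)
      (X.aug.restrictScalars k) H η :=
  X.isTotalComplex.exists_isContraction k X.range_d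

end MinimalResolution

namespace GradedFreeResolution

variable {K : Ideal A} (F : GradedFreeResolution 𝒜 (idealGrading 𝒜 K))

/-- The minimal resolution of an ideal assembled from a sequence of maps of graded free modules. -/
noncomputable def IsMinimal.toMinimalResolution (hF : F.IsMinimal) : MinimalResolution 𝒜 K where
  ι := Σ i, F.ι i
  bideg e := (e.1, F.deg e.1 e.2)
  d := totalDifferential (Equiv.refl _) F.d
  aug := totalAugmentation (Equiv.refl _) (K.subtype ∘ₗ F.aug)
  d_mem := totalDifferential_single_apply_mem (Equiv.refl _)
    (B := fun e f => bidegreePart 𝒜 ((f.1, F.deg f.1 f.2) + (1, 0)) (e.1, F.deg e.1 e.2))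
    fun i p q => mem_bidegreePart_of_mem_shiftedPart
      (mem_freeGrading_iff.1 (F.d_homogeneous i p) q)
  d_minimal := totalDifferential_single_apply_mem (Equiv.refl _)
    (B := fun _ _ => gradedMaximalIdeal 𝒜) fun i _ => mem_smul_top_finsupp_iff.1 (hF i _)
  aug_mem := fun ⟨i, e⟩ => by
    have h := isTotalComplex_total (Equiv.refl _) F.d (K.subtype ∘ₗ F.aug)
    rw [← Equiv.refl_apply (Sigma.mk i e), ← pieceIncl_single]
    cases i with
    | zero =>
      rw [h.aug_zero]
      exact mem_bidegreePart_iff.2 (.inr ⟨_, by simp, F.aug_homogeneous e⟩)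
    | succ i =>
      rw [h.aug_succ]
      exact zero_mem _
  range_d := (isTotalComplex_total (Equiv.refl _) F.d _).range_d_eq_iff.2
    ⟨fun x => Subtype.ext_iff.symm.trans (F.exact_zero x), F.exact_succ⟩
  range_aug := by
    rw [(isTotalComplex_total (Equiv.refl _) F.d _).range_aug_eq, LinearMap.range_comp,
      LinearMap.range_eq_top.2 F.aug_surjective, Submodule.map_top, Submodule.range_subtype]

end GradedFreeResolution

end MinimalResolution

section TensorContraction

variable {k : Type*} [CommRing k] {V V' W W' : Type*} [AddCommGroup V'] [Module k V']
  [AddCommGroup W'] [Module k W'] [AddCommGroup V] [Module k V] [AddCommGroup W] [Module k W]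

/-- The differential of the tensor product of the complexes `(V, d)` and `(V', d')`, where `τ` is
the sign involution of `V`. -/
noncomputable def tensorDifferential (d τ : V →ₗ[k] V) (d' : V' →ₗ[k] V') :
    V ⊗[k] V' →ₗ[k] V ⊗[k] V' :=
  TensorProduct.map d LinearMap.id + TensorProduct.map τ d'

@[simp]
theorem tensorDifferential_tmul (d τ : V →ₗ[k] V) (d' : V' →ₗ[k] V') (x : V) (y : V') :
    tensorDifferential d τ d' (x ⊗ₜ y) = d x ⊗ₜ y + τ x ⊗ₜ d' y := rfl

variable {d τ h : V →ₗ[k] V} {aug : V →ₗ[k] W} {η : W →ₗ[k] V} {d' τ' h' : V' →ₗ[k] V'}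
  {aug' : V' →ₗ[k] W'} {η' : W' →ₗ[k] V'}

namespace IsContraction

theorem tensorDifferential_homotopy (hV : IsContraction d τ aug h η)
    (hV' : IsContraction d' τ' aug' h' η') (z : V ⊗[k] V') :
    tensorDifferential d τ d' (tensorDifferential h (η ∘ₗ aug) h' z) +
      tensorDifferential h (η ∘ₗ aug) h' (tensorDifferential d τ d' z) =
        z - TensorProduct.map η η' (TensorProduct.map aug aug' z) := by
  suffices tensorDifferential d τ d' ∘ₗ tensorDifferential h (η ∘ₗ aug) h' +
      tensorDifferential h (η ∘ₗ aug) h' ∘ₗ tensorDifferential d τ d' =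
        LinearMap.id - TensorProduct.map η η' ∘ₗ TensorProduct.map aug aug' from
    LinearMap.congr_fun this z
  refine TensorProduct.ext' fun x y => ?_
  have hx : d (h x) = x - η (aug x) - h (d x) := by rw [← hV.homotopy, add_sub_cancel_right]
  have hy : d' (h' y) = y - η' (aug' y) - h' (d' y) := by rw [← hV'.homotopy, add_sub_cancel_right]
  simp only [LinearMap.add_apply, LinearMap.comp_apply, LinearMap.sub_apply, LinearMap.id_apply,
    tensorDifferential_tmul, TensorProduct.map_tmul, map_add, hV.aug_d, hV.d_η, hV.sign_η,
    hV.sign_h, hV.aug_sign, map_zero, TensorProduct.zero_tmul, TensorProduct.neg_tmul, hx, hy,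
    TensorProduct.sub_tmul, TensorProduct.tmul_sub]
  abel

theorem range_tensorDifferential (hV : IsContraction d τ aug h η)
    (hV' : IsContraction d' τ' aug' h' η') :
    LinearMap.range (tensorDifferential d τ d') =
      LinearMap.ker (tensorDifferential d τ d') ⊓ LinearMap.ker (TensorProduct.map aug aug') := by
  refine le_antisymm (le_inf ?_ ?_) fun z hz => ⟨tensorDifferential h (η ∘ₗ aug) h' z, ?_⟩
  · refine LinearMap.range_le_ker_iff.2 (TensorProduct.ext' fun x y => ?_)
    simp [hV.d_d, hV.sign_d, hV'.d_d, TensorProduct.neg_tmul]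
  · refine LinearMap.range_le_ker_iff.2 (TensorProduct.ext' fun x y => ?_)
    simp [hV.aug_d, hV'.aug_d]
  · have h_homotopy := hV.tensorDifferential_homotopy hV' z
    rwa [hz.1, hz.2, map_zero, map_zero, add_zero, sub_zero] at h_homotopy

end IsContraction

end TensorContraction

section TensorGrading

variable {k : Type u} [Field k] {R : Type v} [CommRing R] [Algebra k R]
  {S : Type w} [CommRing S] [Algebra k S] {𝒜 : ℕ → Submodule k R} {ℬ : ℕ → Submodule k S}

theorem tmul_mem_tensorGrading {p q : ℕ} {a : R} {b : S} (ha : a ∈ 𝒜 p) (hb : b ∈ ℬ q) :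
    a ⊗ₜ[k] b ∈ tensorGrading 𝒜 ℬ (p + q) :=
  Submodule.mem_iSup_of_mem (p, q) (Submodule.mem_iSup_of_mem
    (Finset.HasAntidiagonal.mem_antidiagonal.2 rfl) ⟨(⟨a, ha⟩ : 𝒜 p) ⊗ₜ (⟨b, hb⟩ : ℬ q), rfl⟩)

theorem range_map_subtype_le {M N : Type*} [AddCommGroup M] [Module k M] [AddCommGroup N]
    [Module k N] {V : Submodule k M} {W : Submodule k N} {P : Submodule k (M ⊗[k] N)}
    (h : ∀ a ∈ V, ∀ b ∈ W, a ⊗ₜ b ∈ P) :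
    LinearMap.range (TensorProduct.map V.subtype W.subtype) ≤ P := by
  rw [TensorProduct.range_map, Submodule.map₂_le]
  simpa using h

theorem tensorGrading_le {n : ℕ} {P : Submodule k (R ⊗[k] S)}
    (h : ∀ p q, p + q = n → ∀ a ∈ 𝒜 p, ∀ b ∈ ℬ q, a ⊗ₜ b ∈ P) : tensorGrading 𝒜 ℬ n ≤ P :=
  iSup₂_le fun p hp =>
    range_map_subtype_le (h p.1 p.2 (Finset.HasAntidiagonal.mem_antidiagonal.1 hp))

theorem tmul_mem_bidegreePart {p p' q q' : ℕ × ℕ} {a : R} {b : S} (ha : a ∈ bidegreePart 𝒜 p p')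
    (hb : b ∈ bidegreePart ℬ q q') :
    a ⊗ₜ[k] b ∈ bidegreePart (tensorGrading 𝒜 ℬ) (p + q) (p' + q') := by
  obtain rfl | ⟨m, rfl, hm⟩ := mem_bidegreePart_iff.1 ha
  · simp
  obtain rfl | ⟨n, rfl, hn⟩ := mem_bidegreePart_iff.1 hb
  · simp
  exact mem_bidegreePart_iff.2 (.inr ⟨m + n, by rw [add_add_add_comm]; rfl,
    tmul_mem_tensorGrading hm hn⟩)

theorem tmul_mem_gradedMaximalIdeal_left [SetLike.GradedOne ℬ] {a : R}
    (ha : a ∈ gradedMaximalIdeal 𝒜) (b : S) :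
    a ⊗ₜ[k] b ∈ gradedMaximalIdeal (tensorGrading 𝒜 ℬ) := by
  suffices gradedMaximalIdeal 𝒜 ≤ (gradedMaximalIdeal (tensorGrading 𝒜 ℬ)).comap
      (Algebra.TensorProduct.includeLeft : R →ₐ[k] R ⊗[k] S) by
    have h : (1 ⊗ₜ b) * (a ⊗ₜ 1) ∈ gradedMaximalIdeal (tensorGrading 𝒜 ℬ) :=
      Ideal.mul_mem_left _ _ (this ha)
    simpa using h
  refine Ideal.span_le.2 ?_
  rintro a ⟨n, hn, ha⟩
  exact mem_gradedMaximalIdeal_of_mem (Nat.add_pos_left hn 0)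
    (tmul_mem_tensorGrading ha SetLike.GradedOne.one_mem)

theorem tmul_mem_gradedMaximalIdeal_right [SetLike.GradedOne 𝒜] (a : R) {b : S}
    (hb : b ∈ gradedMaximalIdeal ℬ) : a ⊗ₜ[k] b ∈ gradedMaximalIdeal (tensorGrading 𝒜 ℬ) := by
  suffices gradedMaximalIdeal ℬ ≤ (gradedMaximalIdeal (tensorGrading 𝒜 ℬ)).comap
      (Algebra.TensorProduct.includeRight : S →ₐ[k] R ⊗[k] S) by
    have h : (a ⊗ₜ 1) * (1 ⊗ₜ b) ∈ gradedMaximalIdeal (tensorGrading 𝒜 ℬ) :=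
      Ideal.mul_mem_left _ _ (this hb)
    simpa using h
  refine Ideal.span_le.2 ?_
  rintro b ⟨n, hn, hb⟩
  exact mem_gradedMaximalIdeal_of_mem (Nat.add_pos_right 0 hn)
    (tmul_mem_tensorGrading SetLike.GradedOne.one_mem hb)

variable [GradedAlgebra 𝒜] [GradedAlgebra ℬ]

instance tensorGrading_gradedMonoid : SetLike.GradedMonoid (tensorGrading 𝒜 ℬ) where
  one_mem := tmul_mem_tensorGrading (p := 0) (q := 0) SetLike.GradedOne.one_mem
    SetLike.GradedOne.one_mem
  mul_mem {i j x y} hx hy := by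
    revert x
    change tensorGrading 𝒜 ℬ i ≤ (tensorGrading 𝒜 ℬ (i + j)).comap (LinearMap.mulRight k y)
    refine tensorGrading_le fun p q hpq a ha b hb => ?_
    revert y
    change tensorGrading 𝒜 ℬ j ≤
      (tensorGrading 𝒜 ℬ (i + j)).comap (LinearMap.mulLeft k (a ⊗ₜ[k] b))
    refine tensorGrading_le fun p' q' hpq' a' ha' b' hb' => ?_
    rw [Submodule.mem_comap, LinearMap.mulLeft_apply, Algebra.TensorProduct.tmul_mul_tmul,
      ← hpq, ← hpq', add_add_add_comm]
    exact tmul_mem_tensorGrading (SetLike.GradedMul.mul_mem ha ha')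
      (SetLike.GradedMul.mul_mem hb hb')

variable (𝒜 ℬ) in
/-- The map decomposing an element of the tensor product into homogeneous components. -/
noncomputable def tensorDecompose : R ⊗[k] S →ₗ[k] DirectSum ℕ (tensorGrading 𝒜 ℬ ·) :=
  DirectSum.toModule k (ℕ × ℕ) (DirectSum ℕ (tensorGrading 𝒜 ℬ ·)) (fun p =>
    DirectSum.lof k ℕ (tensorGrading 𝒜 ℬ ·) (p.1 + p.2) ∘ₗ
      (TensorProduct.map (𝒜 p.1).subtype (ℬ p.2).subtype).codRestrict _
        fun z => range_map_subtype_le (fun _ ha _ hb => tmul_mem_tensorGrading ha hb) ⟨z, rfl⟩) ∘ₗ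
    (TensorProduct.directSum k k (𝒜 ·) (ℬ ·)).toLinearMap ∘ₗ
      TensorProduct.map (DirectSum.decomposeLinearEquiv 𝒜).toLinearMap
        (DirectSum.decomposeLinearEquiv ℬ).toLinearMap

theorem tensorDecompose_tmul {p q : ℕ} {a : R} {b : S} (ha : a ∈ 𝒜 p) (hb : b ∈ ℬ q) :
    tensorDecompose 𝒜 ℬ (a ⊗ₜ b) = DirectSum.lof k ℕ (tensorGrading 𝒜 ℬ ·) (p + q)
      ⟨a ⊗ₜ b, tmul_mem_tensorGrading ha hb⟩ := by
  simp only [tensorDecompose, LinearMap.comp_apply, TensorProduct.map_tmul, LinearEquiv.coe_coe,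
    DirectSum.decomposeLinearEquiv_apply]
  rw [DirectSum.decompose_of_mem 𝒜 ha, DirectSum.decompose_of_mem ℬ hb, ← DirectSum.lof_eq_of k,
    ← DirectSum.lof_eq_of k, TensorProduct.directSum_lof_tmul_lof, DirectSum.toModule_lof]
  rfl

theorem tensorDecompose_of_mem {n : ℕ} {z : R ⊗[k] S} (hz : z ∈ tensorGrading 𝒜 ℬ n) :
    tensorDecompose 𝒜 ℬ z = DirectSum.lof k ℕ (tensorGrading 𝒜 ℬ ·) n ⟨z, hz⟩ := by
  suffices tensorGrading 𝒜 ℬ n ≤ Submodule.map (tensorGrading 𝒜 ℬ n).subtype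
      (LinearMap.eqLocus (tensorDecompose 𝒜 ℬ ∘ₗ (tensorGrading 𝒜 ℬ n).subtype)
        (DirectSum.lof k ℕ (tensorGrading 𝒜 ℬ ·) n)) by
    obtain ⟨y, hy, rfl⟩ := this hz
    exact hy
  refine tensorGrading_le ?_
  rintro p q rfl a ha b hb
  exact ⟨⟨_, tmul_mem_tensorGrading ha hb⟩, tensorDecompose_tmul ha hb, rfl⟩

noncomputable instance tensorGrading_decomposition :
    DirectSum.Decomposition (tensorGrading 𝒜 ℬ) :=
  DirectSum.Decomposition.ofLinearMap _ (tensorDecompose 𝒜 ℬ)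
    (TensorProduct.ext' fun a b => by
      induction a using DirectSum.Decomposition.inductionOn 𝒜 with
      | zero => simp
      | add a a' h h' => rw [TensorProduct.add_tmul, map_add, map_add, h, h']
      | homogeneous a =>
        induction b using DirectSum.Decomposition.inductionOn ℬ with
        | zero => simp
        | add b b' h h' => rw [TensorProduct.tmul_add, map_add, map_add, h, h']
        | homogeneous b =>
          rw [LinearMap.comp_apply, tensorDecompose_tmul a.2 b.2, DirectSum.coeLinearMap_lof]
          rfl)
    (by
      ext n z
      rw [LinearMap.comp_apply, LinearMap.comp_apply, DirectSum.coeLinearMap_lof,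
        tensorDecompose_of_mem z.2]
      rfl)

noncomputable instance tensorGrading_gradedAlgebra : GradedAlgebra (tensorGrading 𝒜 ℬ) where

end TensorGrading

section TensorLift

variable {k : Type*} [CommRing k] {R S : Type*} [CommRing R] [Algebra k R] [CommRing S]
  [Algebra k S] {ι ι' κ κ' : Type*}

theorem finsuppTensorFinsupp_smul_tmul_smul (r : R) (s : S) (x : ι →₀ R) (y : κ →₀ S) :
    finsuppTensorFinsupp k k R S ι κ ((r • x) ⊗ₜ (s • y)) =
      (r ⊗ₜ[k] s) • finsuppTensorFinsupp k k R S ι κ (x ⊗ₜ y) := by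
  ext p
  rw [Finsupp.smul_apply, finsuppTensorFinsupp_apply, finsuppTensorFinsupp_apply, smul_eq_mul,
    Algebra.TensorProduct.tmul_mul_tmul]
  rfl

section

variable {N : Type*} [AddCommGroup N] [Module (R ⊗[k] S) N] [Module k N]

/-- The `R ⊗ S`-linear map which corresponds to a `k`-linear map on the tensor product of free
modules. -/
noncomputable def tensorLift (g : (ι →₀ R) ⊗[k] (κ →₀ S) →ₗ[k] N) :
    (ι × κ →₀ R ⊗[k] S) →ₗ[R ⊗[k] S] N :=
  Finsupp.linearCombination _ fun p => g (Finsupp.single p.1 1 ⊗ₜ Finsupp.single p.2 1)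

theorem tensorLift_single (g : (ι →₀ R) ⊗[k] (κ →₀ S) →ₗ[k] N) (p : ι × κ) :
    tensorLift g (Finsupp.single p 1) = g (Finsupp.single p.1 1 ⊗ₜ Finsupp.single p.2 1) := by
  simp [tensorLift]

theorem tensorLift_finsuppTensorFinsupp [IsScalarTower k (R ⊗[k] S) N]
    {g : (ι →₀ R) ⊗[k] (κ →₀ S) →ₗ[k] N}
    (hg : ∀ (r : R) (s : S) x y, g ((r • x) ⊗ₜ (s • y)) = (r ⊗ₜ[k] s) • g (x ⊗ₜ y))
    (z : (ι →₀ R) ⊗[k] (κ →₀ S)) :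
    tensorLift g (finsuppTensorFinsupp k k R S ι κ z) = g z := by
  suffices (tensorLift g).restrictScalars k ∘ₗ (finsuppTensorFinsupp k k R S ι κ).toLinearMap = g
    from LinearMap.congr_fun this z
  ext e a f b
  simpa [tensorLift] using (hg a b (Finsupp.single e 1) (Finsupp.single f 1)).symm

end

/-- The map on tensor products of free modules induced by two linear maps. -/
noncomputable def tensorMap (f : (ι →₀ R) →ₗ[R] (ι' →₀ R)) (g : (κ →₀ S) →ₗ[S] (κ' →₀ S)) :
    (ι × κ →₀ R ⊗[k] S) →ₗ[R ⊗[k] S] (ι' × κ' →₀ R ⊗[k] S) :=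
  tensorLift ((finsuppTensorFinsupp k k R S ι' κ').toLinearMap ∘ₗ
    TensorProduct.map (f.restrictScalars k) (g.restrictScalars k))

/-- The functional on a tensor product of free modules induced by two functionals. -/
noncomputable def tensorFunctional (f : (ι →₀ R) →ₗ[R] R) (g : (κ →₀ S) →ₗ[S] S) :
    (ι × κ →₀ R ⊗[k] S) →ₗ[R ⊗[k] S] R ⊗[k] S :=
  tensorLift (TensorProduct.map (f.restrictScalars k) (g.restrictScalars k))

theorem tensorMap_single_apply (f : (ι →₀ R) →ₗ[R] (ι' →₀ R)) (g : (κ →₀ S) →ₗ[S] (κ' →₀ S))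
    (p : ι × κ) (q : ι' × κ') :
    tensorMap f g (Finsupp.single p 1) q =
      f (Finsupp.single p.1 1) q.1 ⊗ₜ[k] g (Finsupp.single p.2 1) q.2 := by
  rw [tensorMap, tensorLift_single]
  exact finsuppTensorFinsupp_apply _ _ _ _ _ _ _ _ _ _

theorem tensorMap_finsuppTensorFinsupp (f : (ι →₀ R) →ₗ[R] (ι' →₀ R))
    (g : (κ →₀ S) →ₗ[S] (κ' →₀ S)) (z : (ι →₀ R) ⊗[k] (κ →₀ S)) :
    tensorMap f g (finsuppTensorFinsupp k k R S ι κ z) =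
      finsuppTensorFinsupp k k R S ι' κ'
        (TensorProduct.map (f.restrictScalars k) (g.restrictScalars k) z) :=
  tensorLift_finsuppTensorFinsupp
    (fun r s x y => by simp [finsuppTensorFinsupp_smul_tmul_smul]) z

theorem tensorFunctional_single (f : (ι →₀ R) →ₗ[R] R) (g : (κ →₀ S) →ₗ[S] S) (p : ι × κ) :
    tensorFunctional f g (Finsupp.single p 1) =
      f (Finsupp.single p.1 1) ⊗ₜ[k] g (Finsupp.single p.2 1) :=
  tensorLift_single _ p

theorem tensorFunctional_finsuppTensorFinsupp (f : (ι →₀ R) →ₗ[R] R) (g : (κ →₀ S) →ₗ[S] S)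
    (z : (ι →₀ R) ⊗[k] (κ →₀ S)) :
    tensorFunctional f g (finsuppTensorFinsupp k k R S ι κ z) =
      TensorProduct.map (f.restrictScalars k) (g.restrictScalars k) z :=
  tensorLift_finsuppTensorFinsupp (fun r s x y => by simp) z

end TensorLift

section TensorResolution

variable {k : Type u} [Field k] {R : Type v} [CommRing R] [Algebra k R]
  {S : Type w} [CommRing S] [Algebra k S]

section ExtendedProduct

/-- The product of the extensions of two ideals to the tensor product of their rings. -/
def extendedProduct (k : Type u) [Field k] {R : Type v} [CommRing R] [Algebra k R]
    {S : Type w} [CommRing S] [Algebra k S] (I : Ideal R) (J : Ideal S) : Ideal (R ⊗[k] S) :=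
  I.map (Algebra.TensorProduct.includeLeft : R →ₐ[k] R ⊗[k] S) *
    J.map (Algebra.TensorProduct.includeRight : S →ₐ[k] R ⊗[k] S)

variable {I : Ideal R} {J : Ideal S}

theorem tmul_mem_extendedProduct {a : R} {b : S} (ha : a ∈ I) (hb : b ∈ J) :
    a ⊗ₜ[k] b ∈ extendedProduct k I J := by
  have h := Ideal.mul_mem_mul
    (Ideal.mem_map_of_mem (Algebra.TensorProduct.includeLeft : R →ₐ[k] R ⊗[k] S) ha)
    (Ideal.mem_map_of_mem (Algebra.TensorProduct.includeRight : S →ₐ[k] R ⊗[k] S) hb)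
  simpa [extendedProduct] using h

theorem extendedProduct_le {P : Ideal (R ⊗[k] S)} (h : ∀ a ∈ I, ∀ b ∈ J, a ⊗ₜ[k] b ∈ P) :
    extendedProduct k I J ≤ P := by
  rw [extendedProduct, Ideal.map, Ideal.map, Ideal.span_mul_span', Ideal.span_le]
  rintro _ ⟨_, ⟨a, ha, rfl⟩, _, ⟨b, hb, rfl⟩, rfl⟩
  simpa using h a ha b hb

theorem range_tensorFunctional {ι κ : Type*} (f : (ι →₀ R) →ₗ[R] R) (g : (κ →₀ S) →ₗ[S] S) :
    LinearMap.range (tensorFunctional (k := k) f g) =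
      extendedProduct k (LinearMap.range f) (LinearMap.range g) := by
  refine le_antisymm ?_ (extendedProduct_le ?_)
  · rintro _ ⟨x, rfl⟩
    obtain ⟨z, rfl⟩ := (finsuppTensorFinsupp k k R S ι κ).surjective x
    rw [tensorFunctional_finsuppTensorFinsupp]
    induction z using TensorProduct.induction_on with
    | zero => simp
    | add x y hx hy => rw [map_add]; exact add_mem hx hy
    | tmul x y => exact tmul_mem_extendedProduct ⟨x, rfl⟩ ⟨y, rfl⟩
  · rintro _ ⟨x, rfl⟩ _ ⟨y, rfl⟩
    exact ⟨_, tensorFunctional_finsuppTensorFinsupp f g (x ⊗ₜ y)⟩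

end ExtendedProduct

namespace MinimalResolution

variable {𝒜 : ℕ → Submodule k R} {ℬ : ℕ → Submodule k S} {I I' : Ideal R} {J J' : Ideal S}

theorem pieceSign_single_mem [SetLike.GradedOne 𝒜] (X : MinimalResolution 𝒜 I) (e f : X.ι) :
    pieceSign X.partition (Finsupp.single e 1) f ∈ bidegreePart 𝒜 (X.bideg f) (X.bideg e) := by
  have h := single_one_mem_bidegreePart (𝒜 := 𝒜) X.bideg e f
  rw [pieceSign_apply]
  obtain h_sign | h_sign := neg_one_pow_eq_or R (X.bideg f).1 <;> simp [h_sign, h]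

theorem IsHom.map_pieceSign {X : MinimalResolution 𝒜 I} {X' : MinimalResolution 𝒜 I'}
    {φ : (X.ι →₀ R) →ₗ[R] (X'.ι →₀ R)} (hφ : X.IsHom X' φ) (x : X.ι →₀ R) :
    φ (pieceSign X.partition x) = pieceSign X'.partition (φ x) := by
  suffices φ ∘ₗ pieceSign X.partition = pieceSign X'.partition ∘ₗ φ from
    LinearMap.congr_fun this x
  ext e f
  simp only [LinearMap.comp_apply, Finsupp.lsingle_apply, pieceSign_apply, pieceSign_single,
    map_smul, Finsupp.smul_apply, smul_eq_mul]
  by_cases h : φ (Finsupp.single e 1) f = 0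
  · rw [h, mul_zero, mul_zero]
  · exact congrArg (fun n => (-1) ^ n * _) (fst_eq_of_mem_bidegreePart (hφ.mem e f) h)

/-- The differential of the tensor product of two resolutions. -/
noncomputable def tensorD (X : MinimalResolution 𝒜 I) (Y : MinimalResolution ℬ J) :
    (X.ι × Y.ι →₀ R ⊗[k] S) →ₗ[R ⊗[k] S] (X.ι × Y.ι →₀ R ⊗[k] S) :=
  tensorMap X.d LinearMap.id + tensorMap (pieceSign X.partition) Y.d

variable {X : MinimalResolution 𝒜 I} {Y : MinimalResolution ℬ J} {X' : MinimalResolution 𝒜 I'}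
  {Y' : MinimalResolution ℬ J'}

theorem tensorD_single_apply (p q : X.ι × Y.ι) :
    X.tensorD Y (Finsupp.single p 1) q =
      X.d (Finsupp.single p.1 1) q.1 ⊗ₜ Finsupp.single p.2 1 q.2 +
        pieceSign X.partition (Finsupp.single p.1 1) q.1 ⊗ₜ Y.d (Finsupp.single p.2 1) q.2 := by
  rw [tensorD, LinearMap.add_apply, Finsupp.add_apply, tensorMap_single_apply,
    tensorMap_single_apply, LinearMap.id_apply]

theorem tensorD_finsuppTensorFinsupp (z : (X.ι →₀ R) ⊗[k] (Y.ι →₀ S)) :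
    X.tensorD Y (finsuppTensorFinsupp k k R S X.ι Y.ι z) =
      finsuppTensorFinsupp k k R S X.ι Y.ι (tensorDifferential (X.d.restrictScalars k)
        ((pieceSign X.partition).restrictScalars k) (Y.d.restrictScalars k) z) := by
  rw [tensorD, LinearMap.add_apply, tensorMap_finsuppTensorFinsupp,
    tensorMap_finsuppTensorFinsupp, ← map_add]
  rfl

theorem range_tensorD (X : MinimalResolution 𝒜 I) (Y : MinimalResolution ℬ J) :
    LinearMap.range (X.tensorD Y) =
      LinearMap.ker (X.tensorD Y) ⊓ LinearMap.ker (tensorFunctional X.aug Y.aug) := by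
  obtain ⟨H, η, hX⟩ := X.exists_isContraction
  obtain ⟨H', η', hY⟩ := Y.exists_isContraction
  have h := SetLike.ext_iff.1 (hX.range_tensorDifferential hY)
  ext x
  obtain ⟨z, rfl⟩ := (finsuppTensorFinsupp k k R S X.ι Y.ι).surjective x
  rw [Submodule.mem_inf, LinearMap.mem_ker, LinearMap.mem_ker, tensorD_finsuppTensorFinsupp,
    tensorFunctional_finsuppTensorFinsupp, LinearEquiv.map_eq_zero_iff]
  refine Iff.trans ?_ (h z)
  rw [LinearMap.mem_range, (finsuppTensorFinsupp k k R S X.ι Y.ι).surjective.exists]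
  simp [tensorD_finsuppTensorFinsupp]

variable [GradedAlgebra 𝒜] [GradedAlgebra ℬ]

/-- The tensor product of two minimal resolutions over the field. -/
noncomputable def tensor (X : MinimalResolution 𝒜 I) (Y : MinimalResolution ℬ J) :
    MinimalResolution (tensorGrading 𝒜 ℬ) (extendedProduct k I J) where
  ι := X.ι × Y.ι
  bideg p := X.bideg p.1 + Y.bideg p.2
  d := X.tensorD Y
  aug := tensorFunctional X.aug Y.aug
  d_mem p q := by
    rw [tensorD_single_apply]
    refine add_mem ?_ ?_
    · rw [add_right_comm]
      exact tmul_mem_bidegreePart (X.d_mem p.1 q.1) (single_one_mem_bidegreePart Y.bideg p.2 q.2)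
    · rw [add_assoc]
      exact tmul_mem_bidegreePart (X.pieceSign_single_mem p.1 q.1) (Y.d_mem p.2 q.2)
  d_minimal p q := by
    rw [tensorD_single_apply]
    exact add_mem (tmul_mem_gradedMaximalIdeal_left (X.d_minimal p.1 q.1) _)
      (tmul_mem_gradedMaximalIdeal_right _ (Y.d_minimal p.2 q.2))
  aug_mem p := by
    rw [tensorFunctional_single]
    exact tmul_mem_bidegreePart (X.aug_mem p.1) (Y.aug_mem p.2)
  range_d := X.range_tensorD Y
  range_aug := by rw [range_tensorFunctional, X.range_aug, Y.range_aug]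

theorem IsHom.tensor {φ : (X.ι →₀ R) →ₗ[R] (X'.ι →₀ R)} {ψ : (Y.ι →₀ S) →ₗ[S] (Y'.ι →₀ S)}
    (hφ : X.IsHom X' φ) (hψ : Y.IsHom Y' ψ) :
    (X.tensor Y).IsHom (X'.tensor Y') (tensorMap φ ψ) where
  mem p q := by
    have h := tmul_mem_bidegreePart (hφ.mem p.1 q.1) (hψ.mem p.2 q.2)
    rwa [← tensorMap_single_apply φ ψ p q] at h
  comm x := by
    obtain ⟨z, rfl⟩ := (finsuppTensorFinsupp k k R S X.ι Y.ι).surjective x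
    change X'.tensorD Y' (tensorMap φ ψ (finsuppTensorFinsupp k k R S X.ι Y.ι z)) =
      tensorMap φ ψ (X.tensorD Y (finsuppTensorFinsupp k k R S X.ι Y.ι z))
    rw [tensorMap_finsuppTensorFinsupp, tensorD_finsuppTensorFinsupp, tensorD_finsuppTensorFinsupp,
      tensorMap_finsuppTensorFinsupp]
    induction z using TensorProduct.induction_on with
    | zero => simp only [map_zero]
    | add x y hx hy => simp only [map_add, hx, hy]
    | tmul x y => simp [hφ.comm, hψ.comm, hφ.map_pieceSign]
  aug x := by
    obtain ⟨z, rfl⟩ := (finsuppTensorFinsupp k k R S X.ι Y.ι).surjective x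
    change tensorFunctional X'.aug Y'.aug (tensorMap φ ψ (finsuppTensorFinsupp k k R S X.ι Y.ι z)) =
      tensorFunctional X.aug Y.aug (finsuppTensorFinsupp k k R S X.ι Y.ι z)
    rw [tensorMap_finsuppTensorFinsupp, tensorFunctional_finsuppTensorFinsupp,
      tensorFunctional_finsuppTensorFinsupp]
    induction z using TensorProduct.induction_on with
    | zero => simp only [map_zero]
    | add x y hx hy => simp only [map_add, hx, hy]
    | tmul x y => simp [hφ.aug, hψ.aug]

end MinimalResolution

end TensorResolution

section Cone

variable {A : Type v} [CommRing A]

section SumEquiv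

variable (A) (α β γ : Type*)

/-- The splitting of a free module along a decomposition of its basis into three parts. -/
noncomputable def finsuppSumSum :
    (α ⊕ (β ⊕ γ) →₀ A) ≃ₗ[A] (α →₀ A) × ((β →₀ A) × (γ →₀ A)) :=
  Finsupp.sumFinsuppLEquivProdFinsupp A ≪≫ₗ
    LinearEquiv.prodCongr (LinearEquiv.refl A _) (Finsupp.sumFinsuppLEquivProdFinsupp A)

variable {A α β γ}

@[simp]
theorem finsuppSumSum_symm_inl (p : (α →₀ A) × ((β →₀ A) × (γ →₀ A))) (e : α) :
    (finsuppSumSum A α β γ).symm p (Sum.inl e) = p.1 e := rfl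

@[simp]
theorem finsuppSumSum_symm_inr_inl (p : (α →₀ A) × ((β →₀ A) × (γ →₀ A))) (e : β) :
    (finsuppSumSum A α β γ).symm p (Sum.inr (Sum.inl e)) = p.2.1 e := rfl

@[simp]
theorem finsuppSumSum_symm_inr_inr (p : (α →₀ A) × ((β →₀ A) × (γ →₀ A))) (e : γ) :
    (finsuppSumSum A α β γ).symm p (Sum.inr (Sum.inr e)) = p.2.2 e := rfl

@[simp]
theorem finsuppSumSum_single_inl (e : α) (a : A) :
    finsuppSumSum A α β γ (Finsupp.single (Sum.inl e) a) = (Finsupp.single e a, 0, 0) := by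
  classical
  rw [← LinearEquiv.eq_symm_apply]
  ext (f | f | f) <;> simp [Finsupp.single_apply]

@[simp]
theorem finsuppSumSum_single_inr_inl (e : β) (a : A) :
    finsuppSumSum A α β γ (Finsupp.single (Sum.inr (Sum.inl e)) a) =
      (0, Finsupp.single e a, 0) := by
  classical
  rw [← LinearEquiv.eq_symm_apply]
  ext (f | f | f) <;> simp [Finsupp.single_apply]

@[simp]
theorem finsuppSumSum_single_inr_inr (e : γ) (a : A) :
    finsuppSumSum A α β γ (Finsupp.single (Sum.inr (Sum.inr e)) a) =
      (0, 0, Finsupp.single e a) := by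
  classical
  rw [← LinearEquiv.eq_symm_apply]
  ext (f | f | f) <;> simp [Finsupp.single_apply]

end SumEquiv

section ConeDifferential

variable {U V W N : Type*} [AddCommGroup U] [Module A U] [AddCommGroup V] [Module A V]
  [AddCommGroup W] [Module A W] [AddCommGroup N] [Module A N]

/-- The differential of the mapping cone of `(α, -β) : U → V × W`. -/
def coneDifferential (dU : U →ₗ[A] U) (dV : V →ₗ[A] V) (dW : W →ₗ[A] W) (α : U →ₗ[A] V)
    (β : U →ₗ[A] W) : U × (V × W) →ₗ[A] U × (V × W) :=
  (-dU ∘ₗ LinearMap.fst A U (V × W)).prod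
    (α.prod (-β) ∘ₗ LinearMap.fst A U (V × W) + dV.prodMap dW ∘ₗ LinearMap.snd A U (V × W))

variable {dU : U →ₗ[A] U} {dV : V →ₗ[A] V} {dW : W →ₗ[A] W} {α : U →ₗ[A] V} {β : U →ₗ[A] W}

@[simp]
theorem coneDifferential_apply (u : U) (v : V) (w : W) :
    coneDifferential dU dV dW α β (u, v, w) = (-dU u, α u + dV v, -β u + dW w) := rfl

theorem range_coneDifferential {augU : U →ₗ[A] N} {augV : V →ₗ[A] N} {augW : W →ₗ[A] N}
    (hU : LinearMap.range dU = LinearMap.ker dU ⊓ LinearMap.ker augU)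
    (hV : LinearMap.range dV = LinearMap.ker dV ⊓ LinearMap.ker augV)
    (hW : LinearMap.range dW = LinearMap.ker dW ⊓ LinearMap.ker augW)
    (α_comm : dV ∘ₗ α = α ∘ₗ dU) (β_comm : dW ∘ₗ β = β ∘ₗ dU)
    (α_aug : augV ∘ₗ α = augU) (β_aug : augW ∘ₗ β = augU)
    (h_inf : ∀ n ∈ LinearMap.range augV ⊓ LinearMap.range augW, ∃ u, dU u = 0 ∧ augU u = n) :
    LinearMap.range (coneDifferential dU dV dW α β) =
      LinearMap.ker (coneDifferential dU dV dW α β) ⊓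
        LinearMap.ker (augV.coprod augW ∘ₗ LinearMap.snd A U (V × W)) := by
  have αd u : dV (α u) = α (dU u) := LinearMap.congr_fun α_comm u
  have βd u : dW (β u) = β (dU u) := LinearMap.congr_fun β_comm u
  have αa u : augV (α u) = augU u := LinearMap.congr_fun α_aug u
  have βa u : augW (β u) = augU u := LinearMap.congr_fun β_aug u
  apply le_antisymm
  · rintro _ ⟨⟨u, v, w⟩, rfl⟩
    have hu := hU.le ⟨u, rfl⟩
    have hv := hV.le ⟨v, rfl⟩
    have hw := hW.le ⟨w, rfl⟩
    simp_all
  · rintro ⟨u, v, w⟩ ⟨hd, haug⟩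
    have hd : dU u = 0 ∧ α u + dV v = 0 ∧ -β u + dW w = 0 := by simpa using hd
    obtain ⟨hu, hv, hw⟩ := hd
    have h_aug : augV v + augW w = 0 := haug
    have hu_aug : augU u = 0 := by
      have h := congrArg augV hv
      rwa [map_add, (hV.le ⟨v, rfl⟩).2, add_zero, map_zero, αa] at h
    obtain ⟨u₀, rfl⟩ := hU.ge ⟨hu, hu_aug⟩
    have h_eq : augV (v + α u₀) = augW (-(w - β u₀)) := by
      rw [map_add, map_neg, map_sub, αa, βa, eq_neg_of_add_eq_zero_left h_aug]
      abel
    obtain ⟨u₁, hu₁, h_aug₁⟩ := h_inf _ ⟨⟨_, rfl⟩, ⟨_, h_eq.symm⟩⟩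
    obtain ⟨v', hv'⟩ := hV.ge (show v + α u₀ - α u₁ ∈ _ from ⟨
      by simp [αd, hu₁, add_comm (dV v), hv], by simp [αa, h_aug₁]⟩)
    obtain ⟨w', hw'⟩ := hW.ge (show w - β u₀ + β u₁ ∈ _ from ⟨
      by simp [βd, hu₁, sub_eq_neg_add, hw], by simp [βa, h_aug₁, h_eq]⟩)
    refine ⟨(u₁ - u₀, v', w'), ?_⟩
    simp [hv', hw', hu₁]

end ConeDifferential

namespace MinimalResolution

variable {k : Type u} [Field k] [Algebra k A] {𝒜 : ℕ → Submodule k A} {K L M : Ideal A}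

/-- The differential of the mapping cone of two maps out of a resolution, in coordinates. -/
noncomputable def coneD (X : MinimalResolution 𝒜 K) (Y : MinimalResolution 𝒜 L)
    (Z : MinimalResolution 𝒜 M) (α : (Z.ι →₀ A) →ₗ[A] (X.ι →₀ A))
    (β : (Z.ι →₀ A) →ₗ[A] (Y.ι →₀ A)) :
    (Z.ι ⊕ (X.ι ⊕ Y.ι) →₀ A) →ₗ[A] (Z.ι ⊕ (X.ι ⊕ Y.ι) →₀ A) :=
  (finsuppSumSum A Z.ι X.ι Y.ι).symm.toLinearMap ∘ₗ
    coneDifferential Z.d X.d Y.d α β ∘ₗ (finsuppSumSum A Z.ι X.ι Y.ι).toLinearMap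

/-- The augmentation of the mapping cone, in coordinates. -/
noncomputable def coneAug (X : MinimalResolution 𝒜 K) (Y : MinimalResolution 𝒜 L)
    (Z : MinimalResolution 𝒜 M) : (Z.ι ⊕ (X.ι ⊕ Y.ι) →₀ A) →ₗ[A] A :=
  (X.aug.coprod Y.aug ∘ₗ LinearMap.snd A _ _) ∘ₗ (finsuppSumSum A Z.ι X.ι Y.ι).toLinearMap

variable {X : MinimalResolution 𝒜 K} {Y : MinimalResolution 𝒜 L} {Z : MinimalResolution 𝒜 M}
  {α : (Z.ι →₀ A) →ₗ[A] (X.ι →₀ A)} {β : (Z.ι →₀ A) →ₗ[A] (Y.ι →₀ A)}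

theorem coneD_single_apply_mem {B : Type*} [SetLike B A] [AddSubgroupClass B A]
    {P : Z.ι ⊕ (X.ι ⊕ Y.ι) → Z.ι ⊕ (X.ι ⊕ Y.ι) → B}
    (hZ : ∀ e f, Z.d (Finsupp.single e 1) f ∈ P (.inl e) (.inl f))
    (hX : ∀ e f, X.d (Finsupp.single e 1) f ∈ P (.inr (.inl e)) (.inr (.inl f)))
    (hY : ∀ e f, Y.d (Finsupp.single e 1) f ∈ P (.inr (.inr e)) (.inr (.inr f)))
    (hα : ∀ e f, α (Finsupp.single e 1) f ∈ P (.inl e) (.inr (.inl f)))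
    (hβ : ∀ e f, β (Finsupp.single e 1) f ∈ P (.inl e) (.inr (.inr f)))
    (e f : Z.ι ⊕ (X.ι ⊕ Y.ι)) : coneD X Y Z α β (Finsupp.single e 1) f ∈ P e f := by
  rcases e with e | e | e <;> rcases f with f | f | f <;>
    simp [coneD, zero_mem, hX, hY, hZ, hα, hβ]

theorem range_coneD (hα : Z.IsHom X α) (hβ : Z.IsHom Y β) (hM : K ⊓ L ≤ M) :
    LinearMap.range (coneD X Y Z α β) =
      LinearMap.ker (coneD X Y Z α β) ⊓ LinearMap.ker (coneAug X Y Z) := by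
  have h := SetLike.ext_iff.1 (range_coneDifferential Z.range_d X.range_d Y.range_d
    (LinearMap.ext hα.comm) (LinearMap.ext hβ.comm) (LinearMap.ext hα.aug) (LinearMap.ext hβ.aug)
    (by
      rw [X.range_aug, Y.range_aug]
      exact fun a ha => Z.exists_cycle (hM ha)))
  ext x
  obtain ⟨p, rfl⟩ := (finsuppSumSum A Z.ι X.ι Y.ι).symm.surjective x
  have h_range : (finsuppSumSum A Z.ι X.ι Y.ι).symm p ∈ LinearMap.range (coneD X Y Z α β) ↔
      p ∈ LinearMap.range (coneDifferential Z.d X.d Y.d α β) := by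
    simp only [coneD, LinearMap.mem_range, LinearMap.comp_apply, LinearEquiv.coe_coe,
      EmbeddingLike.apply_eq_iff_eq]
    exact ((finsuppSumSum A Z.ι X.ι Y.ι).surjective.exists (p := fun y =>
      coneDifferential Z.d X.d Y.d α β y = p)).symm
  rw [h_range, h, Submodule.mem_inf, Submodule.mem_inf, LinearMap.mem_ker, LinearMap.mem_ker,
    LinearMap.mem_ker, LinearMap.mem_ker, coneD, coneAug]
  simp only [LinearMap.comp_apply, LinearEquiv.coe_coe, LinearEquiv.apply_symm_apply,
    LinearEquiv.map_eq_zero_iff]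

/-- The mapping cone of two maps with entries in the graded maximal ideal: a minimal resolution of
the sum of two ideals, built from resolutions of the ideals and of their intersection. -/
noncomputable def cone (hα : Z.IsHom X α) (hβ : Z.IsHom Y β)
    (hα' : ∀ e f, α (Finsupp.single e 1) f ∈ gradedMaximalIdeal 𝒜)
    (hβ' : ∀ e f, β (Finsupp.single e 1) f ∈ gradedMaximalIdeal 𝒜) (hM : K ⊓ L ≤ M) :
    MinimalResolution 𝒜 (K ⊔ L) where
  ι := Z.ι ⊕ (X.ι ⊕ Y.ι)
  bideg := Sum.elim (fun e => Z.bideg e + (1, 0)) (Sum.elim X.bideg Y.bideg)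
  d := coneD X Y Z α β
  aug := coneAug X Y Z
  d_mem := coneD_single_apply_mem (fun e f => mem_bidegreePart_add_right _ (Z.d_mem e f)) X.d_mem
    Y.d_mem (fun e f => mem_bidegreePart_add_right _ (hα.mem e f))
    fun e f => mem_bidegreePart_add_right _ (hβ.mem e f)
  d_minimal := coneD_single_apply_mem (P := fun _ _ => gradedMaximalIdeal 𝒜) Z.d_minimal
    X.d_minimal Y.d_minimal hα' hβ'
  aug_mem := by
    rintro (e | e | e)
    · simp [coneAug]
    · simpa [coneAug] using X.aug_mem e
    · simpa [coneAug] using Y.aug_mem e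
  range_d := range_coneD hα hβ hM
  range_aug := by
    rw [coneAug, LinearMap.range_comp_of_range_eq_top _ (LinearEquiv.range _),
      LinearMap.range_comp_of_range_eq_top _ (LinearMap.range_eq_top.2 LinearMap.snd_surjective),
      LinearMap.range_coprod, X.range_aug, Y.range_aug]

variable (hα : Z.IsHom X α) (hβ : Z.IsHom Y β)
  (hα' : ∀ e f, α (Finsupp.single e 1) f ∈ gradedMaximalIdeal 𝒜)
  (hβ' : ∀ e f, β (Finsupp.single e 1) f ∈ gradedMaximalIdeal 𝒜) (hM : K ⊓ L ≤ M)

theorem shape_cone : (cone hα hβ hα' hβ' hM).shape =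
    (· + (1, 0)) '' Z.shape ∪ (X.shape ∪ Y.shape) := by
  rw [shape, shape, ← Set.range_comp]
  exact (Set.Sum.elim_range _ _).trans (congrArg _ (Set.Sum.elim_range _ _))

theorem exists_isHom_cone [SetLike.GradedOne 𝒜] :
    ∃ χ, Y.IsHom (cone hα hβ hα' hβ' hM) χ := by
  refine ⟨(finsuppSumSum A Z.ι X.ι Y.ι).symm.toLinearMap ∘ₗ LinearMap.inr A _ _ ∘ₗ
    LinearMap.inr A _ _, ?_, fun x => ?_, fun x => ?_⟩
  · rintro e (f | f | f)
    · exact zero_mem _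
    · exact zero_mem _
    · exact single_one_mem_bidegreePart Y.bideg e f
  · change (finsuppSumSum A Z.ι X.ι Y.ι).symm (coneDifferential Z.d X.d Y.d α β
      (finsuppSumSum A Z.ι X.ι Y.ι ((finsuppSumSum A Z.ι X.ι Y.ι).symm (0, 0, x)))) =
        (finsuppSumSum A Z.ι X.ι Y.ι).symm (0, 0, Y.d x)
    simp
  · change (X.aug.coprod Y.aug ∘ₗ LinearMap.snd A _ _) (finsuppSumSum A Z.ι X.ι Y.ι
      ((finsuppSumSum A Z.ι X.ι Y.ι).symm (0, 0, x))) = Y.aug x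
    simp

end MinimalResolution

end Cone

section PowerFiltration

variable {k : Type u} [Field k] {R : Type v} [CommRing R] [Algebra k R]
  {S : Type w} [CommRing S] [Algebra k S]

theorem rTensor_eq_self_of_mem_map_includeLeft {I : Ideal R} {p : R →ₗ[k] R}
    (hp : ∀ x ∈ I, p x = x) {z : R ⊗[k] S}
    (hz : z ∈ I.map (Algebra.TensorProduct.includeLeft : R →ₐ[k] R ⊗[k] S)) :
    p.rTensor S z = z := by
  obtain ⟨y, rfl⟩ := (Ideal.map_includeLeft_eq I).le hz
  rw [← LinearMap.comp_apply, ← LinearMap.rTensor_comp]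
  exact congrArg (fun f => LinearMap.rTensor S f y) (LinearMap.ext fun x => hp x x.2)

theorem lTensor_eq_self_of_mem_map_includeRight {J : Ideal S} {q : S →ₗ[k] S}
    (hq : ∀ x ∈ J, q x = x) {z : R ⊗[k] S}
    (hz : z ∈ J.map (Algebra.TensorProduct.includeRight : S →ₐ[k] R ⊗[k] S)) :
    q.lTensor R z = z := by
  obtain ⟨y, rfl⟩ := (Ideal.map_includeRight_eq J).le hz
  rw [← LinearMap.comp_apply, ← LinearMap.lTensor_comp]
  exact congrArg (fun f => LinearMap.lTensor R f y) (LinearMap.ext fun x => hq x x.2)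

theorem exists_isProj_restrictScalars (I : Ideal R) :
    ∃ p : R →ₗ[k] R, LinearMap.IsProj (I.restrictScalars k) p := by
  obtain ⟨p, hp⟩ := (I.restrictScalars k).subtype.exists_leftInverse_of_injective
    (Submodule.ker_subtype _)
  exact ⟨(I.restrictScalars k).subtype ∘ₗ p, fun x => (p x).2,
    fun x hx => congrArg Subtype.val (LinearMap.congr_fun hp ⟨x, hx⟩)⟩

theorem extendedProduct_eq_inf (I : Ideal R) (J : Ideal S) : extendedProduct k I J =
    I.map (Algebra.TensorProduct.includeLeft : R →ₐ[k] R ⊗[k] S) ⊓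
      J.map (Algebra.TensorProduct.includeRight : S →ₐ[k] R ⊗[k] S) := by
  refine le_antisymm Ideal.mul_le_inf ?_
  rintro z ⟨hzI, hzJ⟩
  obtain ⟨p, hp⟩ := exists_isProj_restrictScalars (k := k) I
  obtain ⟨q, hq⟩ := exists_isProj_restrictScalars (k := k) J
  have h_mem : p.rTensor S (q.lTensor R z) ∈ extendedProduct k I J := by
    clear hzI hzJ
    induction z using TensorProduct.induction_on with
    | zero => simp
    | add x y hx hy => rw [map_add, map_add]; exact add_mem hx hy
    | tmul a b => exact tmul_mem_extendedProduct (hp.map_mem a) (hq.map_mem b)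
  rwa [lTensor_eq_self_of_mem_map_includeRight hq.map_id hzJ,
    rTensor_eq_self_of_mem_map_includeLeft hp.map_id hzI] at h_mem

theorem extendedProduct_pow (I : Ideal R) (J : Ideal S) (a b : ℕ) :
    extendedProduct k (I ^ a) (J ^ b) =
      I.map (Algebra.TensorProduct.includeLeft : R →ₐ[k] R ⊗[k] S) ^ a *
        J.map (Algebra.TensorProduct.includeRight : S →ₐ[k] R ⊗[k] S) ^ b := by
  rw [extendedProduct, Ideal.map_pow, Ideal.map_pow]

/-- The partial sums `∑ i ≤ t, I ^ (s - i) J ^ i` of the power `(I + J) ^ s`, for `t ≤ s`. -/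
def powerFiltration (k : Type u) [Field k] {R : Type v} [CommRing R] [Algebra k R]
    {S : Type w} [CommRing S] [Algebra k S] (I : Ideal R) (J : Ideal S) (s : ℕ) :
    ℕ → Ideal (R ⊗[k] S)
  | 0 => extendedProduct k (I ^ s) (J ^ 0)
  | t + 1 => powerFiltration k I J s t ⊔ extendedProduct k (I ^ (s - (t + 1))) (J ^ (t + 1))

variable (I : Ideal R) (J : Ideal S)

theorem powerFiltration_eq_sup (s t : ℕ) : powerFiltration k I J s t =
    (Finset.range (t + 1)).sup fun i => extendedProduct k (I ^ (s - i)) (J ^ i) := by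
  induction t with
  | zero => simp [powerFiltration]
  | succ t ih => rw [powerFiltration, ih, Finset.range_add_one (n := t + 1), Finset.sup_insert,
      sup_comm]

theorem mixedSum_pow (s : ℕ) : mixedSum k I J ^ s = powerFiltration k I J s s := by
  rw [mixedSum, ← Submodule.add_eq_sup, add_comm, add_pow, Ideal.sum_eq_sup,
    powerFiltration_eq_sup]
  refine Finset.sup_congr rfl fun i hi => ?_
  have h_choose : s.choose i ≠ 0 := (Nat.choose_pos (Finset.mem_range_succ_iff.1 hi)).ne'
  rw [extendedProduct_pow, natCast_eq_one h_choose, mul_one, mul_comm]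

theorem powerFiltration_inf_le (s t : ℕ) :
    powerFiltration k I J s t ⊓ extendedProduct k (I ^ (s - (t + 1))) (J ^ (t + 1)) ≤
      extendedProduct k (I ^ (s - t)) (J ^ (t + 1)) := by
  rw [extendedProduct_eq_inf (I ^ (s - t))]
  refine inf_le_inf ?_ Ideal.mul_le_right
  rw [powerFiltration_eq_sup, Finset.sup_le_iff]
  intro i hi
  have h_pow : I ^ (s - i) ≤ I ^ (s - t) := Ideal.pow_le_pow_right (by grind)
  exact Ideal.mul_le_left.trans (Ideal.map_mono h_pow)

end PowerFiltration

section Filtration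

open scoped Pointwise

variable {k : Type u} [Field k] {R : Type v} [CommRing R] [Algebra k R]
  {S : Type w} [CommRing S] [Algebra k S] {𝒜 : ℕ → Submodule k R} {ℬ : ℕ → Submodule k S}

theorem comp_single_apply_mem {A ι κ μ : Type*} [CommRing A] {P : Ideal A}
    (g : (κ →₀ A) →ₗ[A] (μ →₀ A)) {f : (ι →₀ A) →ₗ[A] (κ →₀ A)}
    (hf : ∀ e q, f (Finsupp.single e 1) q ∈ P) (e : ι) (q : μ) :
    (g ∘ₗ f) (Finsupp.single e 1) q ∈ P := by
  rw [LinearMap.comp_apply, linearMap_apply_eq_sum, Finsupp.finsetSum_apply]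
  exact sum_mem fun i _ => Ideal.mul_mem_right _ _ (hf e i)

theorem tensorMap_single_mem_of_left [GradedAlgebra ℬ] {ι₁ ι₂ κ₁ κ₂ : Type*}
    {f : (ι₁ →₀ R) →ₗ[R] (κ₁ →₀ R)}
    (hf : ∀ e q, f (Finsupp.single e 1) q ∈ gradedMaximalIdeal 𝒜)
    (g : (ι₂ →₀ S) →ₗ[S] (κ₂ →₀ S)) (e : ι₁ × ι₂) (q : κ₁ × κ₂) :
    tensorMap (k := k) f g (Finsupp.single e 1) q ∈ gradedMaximalIdeal (tensorGrading 𝒜 ℬ) := by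
  rw [tensorMap_single_apply]
  exact tmul_mem_gradedMaximalIdeal_left (hf e.1 q.1) _

theorem tensorMap_single_mem_of_right [GradedAlgebra 𝒜] {ι₁ ι₂ κ₁ κ₂ : Type*}
    (f : (ι₁ →₀ R) →ₗ[R] (κ₁ →₀ R)) {g : (ι₂ →₀ S) →ₗ[S] (κ₂ →₀ S)}
    (hg : ∀ e q, g (Finsupp.single e 1) q ∈ gradedMaximalIdeal ℬ)
    (e : ι₁ × ι₂) (q : κ₁ × κ₂) :
    tensorMap (k := k) f g (Finsupp.single e 1) q ∈ gradedMaximalIdeal (tensorGrading 𝒜 ℬ) := by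
  rw [tensorMap_single_apply]
  exact tmul_mem_gradedMaximalIdeal_right _ (hg e.2 q.2)

namespace MinimalResolution

variable [GradedAlgebra 𝒜] [GradedAlgebra ℬ] {I : Ideal R} {J : Ideal S}

theorem shape_tensor (X : MinimalResolution 𝒜 I) (Y : MinimalResolution ℬ J) :
    (X.tensor Y).shape = X.shape + Y.shape := by
  ext σ
  simp [shape, Set.mem_add, tensor]

theorem exists_resolution_powerFiltration (X : ∀ a, MinimalResolution 𝒜 (I ^ a))
    (Y : ∀ b, MinimalResolution ℬ (J ^ b))
    (hX : ∀ a, ∃ φ, (X (a + 1)).IsHom (X a) φ ∧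
      ∀ e f, φ (Finsupp.single e 1) f ∈ gradedMaximalIdeal 𝒜)
    (hY : ∀ b, ∃ ψ, (Y (b + 1)).IsHom (Y b) ψ ∧
      ∀ e f, ψ (Finsupp.single e 1) f ∈ gradedMaximalIdeal ℬ) {s t : ℕ} (hts : t ≤ s) :
    ∃ Q : MinimalResolution (tensorGrading 𝒜 ℬ) (powerFiltration k I J s t),
      (∃ χ, ((X (s - t)).tensor (Y t)).IsHom Q χ) ∧
      Q.shape = (⋃ i ∈ Finset.range (t + 1), (X (s - i)).shape + (Y i).shape) ∪
        ⋃ j ∈ Finset.Icc 1 t, (X (s - j + 1)).shape + (Y j).shape + {(1, 0)} := by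
  induction t with
  | zero =>
    refine ⟨(X s).tensor (Y 0), ⟨_, IsHom.id _⟩, ?_⟩
    refine (shape_tensor (X s) (Y 0)).trans ?_
    simp
  | succ t ih =>
    obtain ⟨Q, ⟨χ, hχ⟩, hQ⟩ := ih (Nat.le_of_succ_le hts)
    have h_sub : s - t = s - (t + 1) + 1 := by omega
    obtain ⟨φ, hφ, hφ'⟩ : ∃ φ, (X (s - t)).IsHom (X (s - (t + 1))) φ ∧
        ∀ e f, φ (Finsupp.single e 1) f ∈ gradedMaximalIdeal 𝒜 := by
      rw [h_sub]
      exact hX _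
    obtain ⟨ψ, hψ, hψ'⟩ := hY t
    have hα := hχ.comp ((IsHom.id (X (s - t))).tensor hψ)
    have hβ := hφ.tensor (IsHom.id (Y (t + 1)))
    have hα' := comp_single_apply_mem χ <| tensorMap_single_mem_of_right (k := k) (𝒜 := 𝒜)
      (LinearMap.id : ((X (s - t)).ι →₀ R) →ₗ[R] _) hψ'
    have hβ' := tensorMap_single_mem_of_left (k := k) (ℬ := ℬ) hφ'
      (LinearMap.id : ((Y (t + 1)).ι →₀ S) →ₗ[S] _)
    have h_inf := powerFiltration_inf_le (k := k) I J s t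
    refine ⟨cone hα hβ hα' hβ' h_inf, exists_isHom_cone hα hβ hα' hβ' h_inf, ?_⟩
    refine (shape_cone hα hβ hα' hβ' h_inf).trans ?_
    rw [hQ, shape_tensor, shape_tensor, Finset.range_add_one (n := t + 1),
      Finset.set_biUnion_insert, ← Finset.insert_Icc_right_eq_Icc_add_one le_add_self,
      Finset.set_biUnion_insert, ← h_sub, Set.add_singleton]
    ac_rfl

end MinimalResolution

end Filtration

section AddQuantale

open scoped Pointwise

theorem isAddQuantale_of_exists_residual {Γ : Type*} [AddCommSemigroup Γ] [CompleteLattice Γ]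
    (h : ∀ a z : Γ, ∃ r, ∀ b, a + b ≤ z ↔ b ≤ r) : IsAddQuantale Γ := by
  choose r hr using h
  have h_add a (s : Set Γ) : a + sSup s = ⨆ b ∈ s, a + b :=
    GaloisConnection.l_sSup (l := (a + ·)) (u := r a) fun b z => hr a z b
  exact ⟨h_add, fun s a => by simp only [add_comm _ a, h_add]⟩

instance : IsAddQuantale EReal := by
  refine isAddQuantale_of_exists_residual fun a z => ?_
  obtain rfl | hz := eq_or_ne z ⊤
  · exact ⟨⊤, fun b => by simp⟩
  induction a with
  | bot => exact ⟨⊤, fun b => by simp⟩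
  | coe a =>
    refine ⟨z - a, fun b => ?_⟩
    rw [EReal.le_sub_iff_add_le (.inl (EReal.coe_ne_bot a)) (.inl (EReal.coe_ne_top a)), add_comm]
  | top =>
    refine ⟨⊥, fun b => ⟨fun h => ?_, fun h => by simp [le_bot_iff.1 h]⟩⟩
    by_contra hb
    exact hz (top_le_iff.1 (EReal.top_add_of_ne_bot (mt le_bot_iff.2 hb) ▸ h))

instance : IsAddQuantale (WithBot ℕ∞) := by
  refine isAddQuantale_of_exists_residual fun a z => ?_
  obtain rfl | hz := eq_or_ne z ⊤
  · exact ⟨⊤, fun b => by simp⟩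
  cases a with
  | bot => exact ⟨⊤, fun b => by simp⟩
  | coe a =>
    by_cases haz : (a : WithBot ℕ∞) ≤ z
    · lift z to ℕ∞ using (WithBot.bot_lt_coe a |>.trans_le haz).ne'
      replace haz := WithBot.coe_le_coe.1 haz
      have ha : a ≠ ⊤ := by
        rintro rfl
        exact hz (congrArg _ (top_le_iff.1 haz))
      refine ⟨((z - a : ℕ∞) : WithBot ℕ∞), fun b => ?_⟩
      cases b with
      | bot => simp
      | coe b => exact_mod_cast ((ENat.addLECancellable_of_ne_top ha).le_tsub_iff_left haz).symm
    · refine ⟨⊥, fun b => ⟨fun h => ?_, fun h => by simp [le_bot_iff.1 h]⟩⟩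
      cases b with
      | bot => rfl
      | coe b => exact (haz <| (WithBot.coe_le_coe.2 le_self_add).trans h).elim

variable {Γ : Type*} [AddCommMonoid Γ] [CompleteLattice Γ] [IsAddQuantale Γ]

theorem sSup_add_eq_sSup_add_sSup (s t : Set Γ) : sSup (s + t) = sSup s + sSup t := by
  rw [sSup_add_distrib]
  simp only [add_sSup_distrib, ← Set.image2_add, sSup_image2]

theorem sSup_image_filtration_shape (f : ℕ × ℕ →+ Γ) (A B : ℕ → Set (ℕ × ℕ)) (s : ℕ) :
    sSup (f '' ((⋃ i ∈ Finset.range (s + 1), A (s - i) + B i) ∪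
        ⋃ j ∈ Finset.Icc 1 s, A (s - j + 1) + B j + {(1, 0)})) =
      ((Finset.range (s + 1)).sup fun i => sSup (f '' A (s - i)) + sSup (f '' B i)) ⊔
        (Finset.Icc 1 s).sup fun j =>
          sSup (f '' A (s - j + 1)) + sSup (f '' B j) + f (1, 0) := by
  simp only [Set.image_union, Set.image_iUnion₂, Set.image_add, sSup_union, sSup_iUnion,
    Set.image_singleton, sSup_add_eq_sSup_add_sSup, sSup_singleton, Finset.sup_eq_iSup]

theorem sup_range_sup_sup_Icc_eq {x y : ℕ → Γ} {c : Γ} (hx : x 0 ≤ x 1 + c) (hy : y 0 ≤ y 1 + c)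
    {s : ℕ} (hs : 1 ≤ s) :
    ((Finset.range (s + 1)).sup fun i => x (s - i) + y i) ⊔
        ((Finset.Icc 1 s).sup fun j => x (s - j + 1) + y j + c) =
      ((Finset.Icc 1 (s - 1)).sup fun i => x (s - i) + y i) ⊔
        (Finset.Icc 1 s).sup fun j => x (s - j + 1) + y j + c := by
  refine le_antisymm (sup_le (Finset.sup_le fun i hi => ?_) le_sup_right)
    (sup_le_sup_right (Finset.sup_mono fun i hi => ?_) _)
  · have h_right j (hj : j ∈ Finset.Icc 1 s) := le_sup_of_le_right
      (a := (Finset.Icc 1 (s - 1)).sup fun i => x (s - i) + y i)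
      (Finset.le_sup (f := fun j => x (s - j + 1) + y j + c) hj)
    obtain rfl | hi0 := Nat.eq_zero_or_pos i
    · refine le_trans ?_ (h_right 1 (Finset.mem_Icc.2 ⟨le_rfl, hs⟩))
      rw [Nat.sub_zero, Nat.sub_add_cancel hs, add_assoc]
      exact add_le_add_right hy _
    obtain rfl | his := eq_or_ne i s
    · refine le_trans ?_ (h_right i (Finset.mem_Icc.2 ⟨hs, le_rfl⟩))
      rw [Nat.sub_self, zero_add, add_right_comm]
      exact add_le_add_left hx _
    · exact le_sup_of_le_left (Finset.le_sup (f := fun i => x (s - i) + y i) (by grind))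
  · grind

end AddQuantale

section Invariants

/-- The homological degree of a bidegree, with values in the type of projective dimensions. -/
noncomputable def homologicalDegree : ℕ × ℕ →+ WithBot ℕ∞ :=
  (Nat.castAddMonoidHom _).comp (AddMonoidHom.fst ℕ ℕ)

/-- The internal degree of a bidegree minus its homological degree, whose supremum over the shape
of a minimal resolution is the regularity. -/
noncomputable def regularityDegree : ℕ × ℕ →+ EReal where
  toFun σ := (((σ.2 : ℝ) - (σ.1 : ℝ) : ℝ) : EReal)
  map_zero' := by simp
  map_add' σ τ := by
    rw [← EReal.coe_add, Prod.fst_add, Prod.snd_add, Nat.cast_add, Nat.cast_add,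
      add_sub_add_comm]

theorem homologicalDegree_one_zero : homologicalDegree (1, 0) = 1 := Nat.cast_one

theorem regularityDegree_one_zero : regularityDegree (1, 0) = -1 := by
  simp [regularityDegree]

theorem eq_of_forall_le_natCast_iff {x y : WithBot ℕ∞} (hx : 0 ≤ x) (hy : 0 ≤ y)
    (h : ∀ n : ℕ, x ≤ n ↔ y ≤ n) : x = y := by
  lift x to ℕ∞ using (WithBot.bot_lt_coe _ |>.trans_le hx).ne'
  lift y to ℕ∞ using (WithBot.bot_lt_coe _ |>.trans_le hy).ne'
  refine congrArg _ (eq_of_forall_ge_iff fun c => ?_)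
  cases c with
  | top => simp
  | coe n => exact WithBot.coe_le_coe.symm.trans ((h n).trans WithBot.coe_le_coe)

theorem idealProjDim_nonneg {A : Type v} [CommRing A] {K : Ideal A} (hK : K ≠ ⊥) :
    0 ≤ idealProjDim K := by
  rw [idealProjDim, ← Nat.cast_zero, projectiveDimension_ge_iff,
    hasProjectiveDimensionLT_zero_iff_isZero, ModuleCat.isZero_iff_subsingleton]
  exact fun h => hK (Submodule.subsingleton_iff_eq_bot.1 h)

theorem idealProjDim_top_le (A : Type v) [CommRing A] : idealProjDim (⊤ : Ideal A) ≤ 0 := by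
  have : Projective (ModuleCat.of A (⊤ : Ideal A)) :=
    (IsProjective.iff_projective _).1 (Module.Projective.of_equiv Submodule.topEquiv.symm)
  exact (projectiveDimension_le_iff _ 0).2 inferInstance

variable {k : Type u} [Field k] {A : Type v} [CommRing A] [Algebra k A]
  {𝒜 : ℕ → Submodule k A} {K : Ideal A}

namespace MinimalResolution

theorem exists_aug_ne_zero (X : MinimalResolution 𝒜 K) (hK : K ≠ ⊥) :
    ∃ e, X.aug (Finsupp.single e 1) ≠ 0 := by
  by_contra! h
  have h_aug : X.aug = 0 := Finsupp.lhom_ext' fun e => LinearMap.ext_ring (by simpa using h e)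
  exact hK (by rw [← X.range_aug, h_aug, LinearMap.range_zero])

theorem exists_mem_shape_fst_eq_zero (X : MinimalResolution 𝒜 K)
    (h0 : 𝒜 0 = (⊥ : Subalgebra k A).toSubmodule) (hK : K ≠ ⊥) (hK' : K ≠ ⊤) :
    ∃ n ≠ 0, (0, n) ∈ X.shape := by
  obtain ⟨e, he⟩ := X.exists_aug_ne_zero hK
  obtain ⟨n, hn, h_aug⟩ := (mem_bidegreePart_iff.1 (X.aug_mem e)).resolve_left he
  refine ⟨n, ?_, e, by rw [hn, zero_add]⟩
  rintro rfl
  rw [h0] at h_aug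
  obtain ⟨c, hc⟩ := Algebra.mem_bot.1 h_aug
  have hc0 : c ≠ 0 := by
    rintro rfl
    exact he (by rw [← hc, map_zero])
  have h_mem : algebraMap k A c ∈ K := hc ▸ X.range_aug.le ⟨_, rfl⟩
  exact hK' (Ideal.eq_top_of_isUnit_mem K h_mem (hc0.isUnit.map _))

/-- The resolution of the unit ideal by a free module of rank one. -/
noncomputable def unit (𝒜 : ℕ → Submodule k A) [SetLike.GradedOne 𝒜] :
    MinimalResolution 𝒜 (⊤ : Ideal A) where
  ι := PUnit
  bideg _ := 0
  d := 0
  aug := Finsupp.lapply PUnit.unit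
  d_mem _ _ := zero_mem _
  d_minimal _ _ := zero_mem _
  aug_mem e := mem_bidegreePart_iff.2 (Or.inr ⟨0, rfl, by simpa using SetLike.GradedOne.one_mem⟩)
  range_d := by
    rw [LinearMap.range_zero, LinearMap.ker_zero, top_inf_eq, eq_comm, LinearMap.ker_eq_bot']
    exact fun x hx => Finsupp.ext fun _ => hx
  range_aug := LinearMap.range_eq_top.2 fun a => ⟨Finsupp.single PUnit.unit a, by simp⟩

theorem shape_unit (𝒜 : ℕ → Submodule k A) [SetLike.GradedOne 𝒜] : (unit 𝒜).shape = {0} :=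
  Set.range_const (ι := PUnit)

variable [GradedAlgebra 𝒜] [Nontrivial A]

theorem idealProjDim_le_iff (X : MinimalResolution 𝒜 K) (n : ℕ) :
    idealProjDim K ≤ n ↔ ∀ σ ∈ X.shape, σ.1 ≤ n := by
  rw [idealProjDim, X.toGraded_isMinimal.projectiveDimension_le_iff]
  constructor
  · rintro h _ ⟨e, rfl⟩
    exact h _ ⟨⟨e, rfl⟩⟩
  · rintro h i ⟨e, rfl⟩
    exact h _ ⟨e, rfl⟩

theorem idealProjDim_eq (X : MinimalResolution 𝒜 K) (hK : K ≠ ⊥) :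
    idealProjDim K = sSup (homologicalDegree '' X.shape) := by
  obtain ⟨e, -⟩ := X.exists_aug_ne_zero hK
  have h_nonneg : 0 ≤ homologicalDegree (X.bideg e) := Nat.cast_nonneg _
  refine eq_of_forall_le_natCast_iff (idealProjDim_nonneg hK)
    (h_nonneg.trans (le_sSup ⟨_, ⟨e, rfl⟩, rfl⟩)) fun n => ?_
  rw [X.idealProjDim_le_iff, sSup_le_iff, Set.forall_mem_image]
  exact forall₂_congr fun σ _ => Nat.cast_le.symm

theorem idealReg_eq (X : MinimalResolution 𝒜 K) :
    idealReg 𝒜 K = sSup (regularityDegree '' X.shape) := by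
  let _ := idealGradingDecomposition X.isHomogeneous
  rw [idealReg, X.toGraded_isMinimal.regularity_eq]
  congr 1
  ext x
  constructor
  · rintro ⟨i, ⟨e, rfl⟩, rfl⟩
    exact ⟨_, ⟨e, rfl⟩, rfl⟩
  · rintro ⟨_, ⟨e, rfl⟩, rfl⟩
    exact ⟨_, ⟨e, rfl⟩, rfl⟩

theorem one_le_idealReg (X : MinimalResolution 𝒜 K)
    (h0 : 𝒜 0 = (⊥ : Subalgebra k A).toSubmodule) (hK : K ≠ ⊥) (hK' : K ≠ ⊤) :
    1 ≤ idealReg 𝒜 K := by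
  obtain ⟨n, hn, h_mem⟩ := X.exists_mem_shape_fst_eq_zero h0 hK hK'
  rw [X.idealReg_eq]
  refine le_trans ?_ (le_sSup ⟨_, h_mem, rfl⟩)
  have h_one : (1 : ℝ) ≤ (n : ℝ) - (0 : ℕ) := by
    simpa using Nat.one_le_iff_ne_zero.2 hn
  exact EReal.coe_le_coe h_one

end MinimalResolution

variable (𝒜) [GradedAlgebra 𝒜] [Nontrivial A]

theorem idealReg_top : idealReg 𝒜 ⊤ = 0 := by
  rw [(MinimalResolution.unit 𝒜).idealReg_eq, MinimalResolution.shape_unit, Set.image_singleton,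
    sSup_singleton, map_zero]

end Invariants

theorem exists_minimalResolution_pow {k : Type u} [Field k] {A : Type v} [CommRing A] [Algebra k A]
    {𝒜 : ℕ → Submodule k A} [GradedAlgebra 𝒜] {I : Ideal A}
    (h0 : 𝒜 0 = (⊥ : Subalgebra k A).toSubmodule) (hI : I.IsHomogeneous 𝒜)
    (h_small : IsSmallType 𝒜 I) : ∃ X : ∀ a, MinimalResolution 𝒜 (I ^ a),
      ∀ a, ∃ φ, (X (a + 1)).IsHom (X a) φ ∧
        ∀ e f, φ (Finsupp.single e 1) f ∈ gradedMaximalIdeal 𝒜 := by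
  have h_pow a : (I ^ a).IsHomogeneous 𝒜 := by
    induction a with
    | zero =>
      rw [pow_zero, Ideal.one_eq_top]
      exact Ideal.IsHomogeneous.top 𝒜
    | succ a ih => exact pow_succ I a ▸ ih.mul hI
  have h_exists a : ∃ F : GradedFreeResolution 𝒜 (idealGrading 𝒜 (I ^ a)), F.IsMinimal := by
    let _ := idealGradingDecomposition (h_pow a)
    exact GradedFreeResolution.exists_isMinimal h0
  choose F hF using h_exists
  exact ⟨fun a => (hF a).toMinimalResolution, fun a =>
    MinimalResolution.exists_isHom_of_tor_map_eq_zero _ _ (Ideal.pow_le_pow_right (Nat.le_succ a))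
      (h_small a)⟩

theorem mixedSum_pow_ne_bot {k : Type u} [Field k] {R : Type v} [CommRing R] [Algebra k R]
    {S : Type w} [CommRing S] [Algebra k S] [Nontrivial S] {I : Ideal R} (J : Ideal S) {s : ℕ}
    (hI : I ^ s ≠ ⊥) : mixedSum k I J ^ s ≠ ⊥ := by
  intro h
  have h_map : (I ^ s).map (Algebra.TensorProduct.includeLeft : R →ₐ[k] R ⊗[k] S) = ⊥ := by
    rw [eq_bot_iff, ← h, Ideal.map_pow]
    exact Ideal.pow_right_mono le_sup_left s
  exact hI ((Ideal.map_eq_bot_iff_of_injective (Algebra.TensorProduct.includeLeft_injective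
    (S := k) (algebraMap k S).injective)).1 h_map)

theorem ideal_pow_ne_bot {A : Type v} [CommRing A] [Nontrivial A] {I : Ideal A}
    (hI : ∀ i, 1 ≤ i → I ^ i ≠ ⊥) (a : ℕ) : I ^ a ≠ ⊥ := by
  obtain rfl | ha := Nat.eq_zero_or_pos a
  · rw [pow_zero, Ideal.one_eq_top]
    exact top_ne_bot
  · exact hI a ha

theorem idealProjDim_pow_zero_le {A : Type v} [CommRing A] {I : Ideal A} (hI : I ^ 1 ≠ ⊥) :
    idealProjDim (I ^ 0) ≤ idealProjDim (I ^ 1) + 1 := by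
  rw [pow_zero, Ideal.one_eq_top]
  exact (idealProjDim_top_le A).trans (add_nonneg (idealProjDim_nonneg hI) zero_le_one)

theorem idealReg_pow_zero_le {k : Type u} [Field k] {A : Type v} [CommRing A] [Algebra k A]
    [Nontrivial A] {𝒜 : ℕ → Submodule k A} [GradedAlgebra 𝒜] {I : Ideal A}
    (X : MinimalResolution 𝒜 (I ^ 1)) (h0 : 𝒜 0 = (⊥ : Subalgebra k A).toSubmodule)
    (hI : I ^ 1 ≠ ⊥) (hI' : I ≠ ⊤) : idealReg 𝒜 (I ^ 0) ≤ idealReg 𝒜 (I ^ 1) + -1 := by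
  rw [pow_zero, Ideal.one_eq_top, idealReg_top]
  calc (0 : EReal) = 1 + -1 := congrArg Real.toEReal (add_neg_cancel (1 : ℝ)).symm
    _ ≤ idealReg 𝒜 (I ^ 1) + -1 := add_le_add_left (X.one_le_idealReg h0 hI (by rwa [pow_one])) _

theorem mainTheorem5_general {k : Type u} [Field k]
    {R : Type v} [CommRing R] [Algebra k R] (𝒜 : ℕ → Submodule k R) [GradedAlgebra 𝒜]
    {S : Type w} [CommRing S] [Algebra k S] (ℬ : ℕ → Submodule k S) [GradedAlgebra ℬ]
    (hR : 𝒜 0 = (⊥ : Subalgebra k R).toSubmodule) (hS : ℬ 0 = (⊥ : Subalgebra k S).toSubmodule)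
    (I : Ideal R) (J : Ideal S)
    (hI : I.IsHomogeneous 𝒜) (hJ : J.IsHomogeneous ℬ)
    (hI_proper : I ≠ ⊤) (hJ_proper : J ≠ ⊤)
    (hI_small : IsSmallType 𝒜 I) (hJ_small : IsSmallType ℬ J)
    (hI_pow : ∀ i : ℕ, 1 ≤ i → I ^ i ≠ ⊥) (hJ_pow : ∀ i : ℕ, 1 ≤ i → J ^ i ≠ ⊥)
    (s : ℕ) (hs : 1 ≤ s) :
    idealProjDim (mixedSum k I J ^ s) =
      max
        ((Finset.Icc 1 (s - 1)).sup fun i => idealProjDim (I ^ (s - i)) + idealProjDim (J ^ i))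
        ((Finset.Icc 1 s).sup fun j =>
          idealProjDim (I ^ (s - j + 1)) + idealProjDim (J ^ j) + 1) ∧
    idealReg (tensorGrading 𝒜 ℬ) (mixedSum k I J ^ s) =
      max
        ((Finset.Icc 1 (s - 1)).sup fun i => idealReg 𝒜 (I ^ (s - i)) + idealReg ℬ (J ^ i))
        ((Finset.Icc 1 s).sup fun j =>
          idealReg 𝒜 (I ^ (s - j + 1)) + idealReg ℬ (J ^ j) - 1) := by
  have : Nontrivial R := (Submodule.nontrivial_iff R).1 ⟨I, ⊤, hI_proper⟩
  have : Nontrivial S := (Submodule.nontrivial_iff S).1 ⟨J, ⊤, hJ_proper⟩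
  obtain ⟨X, hX⟩ := exists_minimalResolution_pow hR hI hI_small
  obtain ⟨Y, hY⟩ := exists_minimalResolution_pow hS hJ hJ_small
  obtain ⟨Q, -, hQ⟩ := MinimalResolution.exists_resolution_powerFiltration X Y hX hY (le_refl s)
  have hP := mixedSum_pow_ne_bot (k := k) J (hI_pow s hs)
  rw [mixedSum_pow] at hP ⊢
  have hI_ne := ideal_pow_ne_bot hI_pow
  have hJ_ne := ideal_pow_ne_bot hJ_pow
  constructor
  · rw [Q.idealProjDim_eq hP, hQ, sSup_image_filtration_shape _ (fun a => (X a).shape)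
      (fun b => (Y b).shape), homologicalDegree_one_zero]
    simp only [← (X _).idealProjDim_eq (hI_ne _), ← (Y _).idealProjDim_eq (hJ_ne _)]
    exact sup_range_sup_sup_Icc_eq (x := fun a => idealProjDim (I ^ a))
      (y := fun b => idealProjDim (J ^ b)) (idealProjDim_pow_zero_le (hI_ne 1))
      (idealProjDim_pow_zero_le (hJ_ne 1)) hs
  · rw [Q.idealReg_eq, hQ, sSup_image_filtration_shape _ (fun a => (X a).shape)
      (fun b => (Y b).shape), regularityDegree_one_zero]
    simp only [← (X _).idealReg_eq, ← (Y _).idealReg_eq, sub_eq_add_neg]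
    exact sup_range_sup_sup_Icc_eq (x := fun a => idealReg 𝒜 (I ^ a))
      (y := fun b => idealReg ℬ (J ^ b)) (idealReg_pow_zero_le (X 1) hR (hI_ne 1) hI_proper)
      (idealReg_pow_zero_le (Y 1) hS (hJ_ne 1) hJ_proper) hs

theorem mainTheorem5 {k : Type u} [Field k]
    {R : Type v} [CommRing R] [Algebra k R] (𝒜 : ℕ → Submodule k R) [GradedAlgebra 𝒜]
    {S : Type w} [CommRing S] [Algebra k S] (ℬ : ℕ → Submodule k S) [GradedAlgebra ℬ]
    (hR : IsStandardGraded 𝒜) (hS : IsStandardGraded ℬ)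
    (I : Ideal R) (J : Ideal S)
    (hI : I.IsHomogeneous 𝒜) (hJ : J.IsHomogeneous ℬ)
    (hI_proper : I ≠ ⊤) (hJ_proper : J ≠ ⊤)
    (hI_small : IsSmallType 𝒜 I) (hJ_small : IsSmallType ℬ J)
    (hI_pow : ∀ i : ℕ, 1 ≤ i → I ^ i ≠ ⊥) (hJ_pow : ∀ i : ℕ, 1 ≤ i → J ^ i ≠ ⊥)
    (s : ℕ) (hs : 1 ≤ s) :
    idealProjDim (mixedSum k I J ^ s) =
      max
        ((Finset.Icc 1 (s - 1)).sup fun i => idealProjDim (I ^ (s - i)) + idealProjDim (J ^ i))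
        ((Finset.Icc 1 s).sup fun j =>
          idealProjDim (I ^ (s - j + 1)) + idealProjDim (J ^ j) + 1) ∧
    idealReg (tensorGrading 𝒜 ℬ) (mixedSum k I J ^ s) =
      max
        ((Finset.Icc 1 (s - 1)).sup fun i => idealReg 𝒜 (I ^ (s - i)) + idealReg ℬ (J ^ i))
        ((Finset.Icc 1 s).sup fun j =>
          idealReg 𝒜 (I ^ (s - j + 1)) + idealReg ℬ (J ^ j) - 1) :=
  mainTheorem5_general 𝒜 ℬ hR.degree_zero hS.degree_zero I J hI hJ hI_proper hJ_proper hI_small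
    hJ_small hI_pow hJ_pow s hs
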